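/- Let $n,m\ge 0$ be integers, let $M$ be a complete, non-compact smooth Riemannian manifold of dimension $n$ (without boundary), and let $X:M\to\mathbb R^{n+m}$ be a smooth isometric immersion that is proper (preimages of compact sets are compact). For $p\in M$ and $v\in\mathbb R^{n+m}$ let $v^N$ denote the component of $v$ orthogonal to $dX_p(T_pM)$, let $B(V,W)=(\overline\nabla_VW)^N$ be the second fundamental form, where $\overline\nabla$ is the flat connection of $\mathbb R^{n+m}$, and let $H=\sum_{i=1}^nB(e_i,e_i)$, with $(e_i)$ an orthonormal basis of the tangent space, be the mean curvature vector. Suppose that $M$ is a self-shrinker, that is, $H=-\tfrac12X^N$ on $M$. For $t>0$ put $$F_t(M)=\frac1{(4\pi t)^{n/2}}\int_M e^{-\frac{|X|^2}{4t}}\,d\mu,$$ where $\mu$ is the Riemannian volume measure of $M$. Then for every $t>0$ the integral defining $F_t(M)$ is finite, and $F_t(M)\le F_1(M)$. -/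

import Mathlib

open MeasureTheory Bundle Manifold
open scoped ContDiff Real

/-- The model space `ℝ^k` with its Euclidean norm. -/
abbrev Euc (k : ℕ) : Type := EuclideanSpace ℝ (Fin k)

noncomputable section

section Volume

variable {n : ℕ} {M : Type*} [TopologicalSpace M] [ChartedSpace (Euc n) M]
  [RiemannianBundle (fun p : M => TangentSpace (𝓡 n) p)]

/-- The matrix `g_ij = ⟨∂_i, ∂_j⟩` of the Riemannian metric of `M` in the chart `e`, at the point of
`M` with coordinates `y`; here `∂_i` is the image of the `i`-th standard basis vector under the
differential of the inverse chart. -/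
def metricMatrix (e : OpenPartialHomeomorph M (Euc n)) (y : Euc n) : Matrix (Fin n) (Fin n) ℝ :=
  Matrix.of fun i j =>
    inner ℝ (mfderiv (𝓡 n) (𝓡 n) e.symm y (EuclideanSpace.single i (1 : ℝ) : Euc n))
      (mfderiv (𝓡 n) (𝓡 n) e.symm y (EuclideanSpace.single j (1 : ℝ) : Euc n))

variable [MeasurableSpace M]

/-- The Riemannian volume of the domain of the chart `e`, as a measure on `M`:
`A ↦ ∫ √(det g_ij) dy` over the points `y` of the target of `e` whose inverse image lies in `A`. -/
def chartVolume (e : OpenPartialHomeomorph M (Euc n)) : Measure M :=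
  ((volume.restrict e.target).withDensity
    fun y => ENNReal.ofReal (Real.sqrt (metricMatrix e y).det)).map e.symm

variable (n M) in
/-- The Riemannian volume measure of `M`. The measures `chartVolume e` agree on overlaps of charts
(change of variables), and their supremum in the lattice of measures is the measure on `M` that
restricts to `chartVolume e` on the domain of every chart `e` of the atlas. -/
def riemannianVolume : Measure M :=
  ⨆ e ∈ atlas (Euc n) M, chartVolume e

end Volume

section Immersion

variable (n : ℕ) {k : ℕ} {M : Type*} [TopologicalSpace M] [ChartedSpace (Euc n) M]

/-- The differential `dX_p : T_pM → ℝ^k`. -/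
def differential (X : M → Euc k) (p : M) : TangentSpace (𝓡 n) p →L[ℝ] Euc k :=
  mfderiv (𝓡 n) 𝓘(ℝ, Euc k) X p

/-- The tangent space of the immersed submanifold at `p`, a linear subspace of `ℝ^k`. -/
def tangentPlane (X : M → Euc k) (p : M) : Submodule ℝ (Euc k) :=
  LinearMap.range (differential n X p : TangentSpace (𝓡 n) p →ₗ[ℝ] Euc k)

/-- The normal part `v^N` at `p` of a vector `v` of `ℝ^k`. -/
def normalPart (X : M → Euc k) (p : M) (v : Euc k) : Euc k :=
  (tangentPlane n X p)ᗮ.starProjection v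

/-- The second fundamental form `B(v, w) = (∇̄_V W)^N` at `p`, where `∇̄` is the flat connection of
`ℝ^k` and where `v` and `w` are extended to the vector fields `V` and `W` with constant
coefficients in the preferred chart at `p`. (In Mathlib a tangent vector at `p` is its
coordinate vector in that chart, and `B` does not depend on the extensions.) -/
def secondFundamentalForm (X : M → Euc k) (p : M) (v w : TangentSpace (𝓡 n) p) : Euc k :=
  normalPart n X p
    (fderiv ℝ (fderiv ℝ (X ∘ (chartAt (Euc n) p).symm)) (chartAt (Euc n) p p)
      (show Euc n from v) (show Euc n from w))

variable [RiemannianBundle (fun p : M => TangentSpace (𝓡 n) p)]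

/-- `X` is a smooth isometric immersion of the Riemannian manifold `M` into `ℝ^k`. (Preservation
of inner products makes each differential injective.) -/
def IsIsometricImmersion (X : M → Euc k) : Prop :=
  ContMDiff (𝓡 n) 𝓘(ℝ, Euc k) ∞ X ∧
    ∀ (p : M) (v w : TangentSpace (𝓡 n) p),
      inner ℝ (differential n X p v) (differential n X p w) = inner ℝ v w

instance finiteDimensional_tangentSpace (p : M) : FiniteDimensional ℝ (TangentSpace (𝓡 n) p) :=
  inferInstanceAs (FiniteDimensional ℝ (Euc n))

/-- The mean curvature vector `H = ∑ B(e_i, e_i)` at `p`, with `(e_i)` an orthonormal basis of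
`T_pM`. -/
def meanCurvature (X : M → Euc k) (p : M) : Euc k :=
  ∑ i, secondFundamentalForm n X p (stdOrthonormalBasis ℝ (TangentSpace (𝓡 n) p) i)
    (stdOrthonormalBasis ℝ (TangentSpace (𝓡 n) p) i)

/-- The self-shrinker equation `H = -X^N / 2`. -/
def IsSelfShrinker (X : M → Euc k) : Prop :=
  ∀ p : M, meanCurvature n X p = -(1 / 2 : ℝ) • normalPart n X p (X p)

/-- The Gaussian weight `e^{-|X|² / 4t}`. -/
def gaussianWeight (X : M → Euc k) (t : ℝ) (p : M) : ℝ :=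
  Real.exp (-‖X p‖ ^ 2 / (4 * t))

variable [MeasurableSpace M]

/-- The functional `F_t(Ω) = (4πt)^{-n/2} ∫_Ω e^{-|X|² / 4t} dμ`, with `μ` the Riemannian volume
of `M`. -/
def gaussianArea (X : M → Euc k) (t : ℝ) (Ω : Set M) : ℝ :=
  (4 * π * t) ^ (-(n : ℝ) / 2) * ∫ p in Ω, gaussianWeight X t p ∂(riemannianVolume n M)

end Immersion

end

/-! Write f = |X|²/4, a = |X^T|²/4, b = |X^N|²/4, d = n/2 and β = 1/t. Then a + b = f and ∇f =
X^T/2, so |∇f|² = a; the shrinker equation gives div X^T = n + ⟨X^N, H⟩ = n - |X^N|²/2, that is, Δf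
= d - b. Up to the factor (4π)^{-d}, F_t is I(β) = β^d ∫ e^{-βf}.

Formally, integrating div(e^{-βf} ∇f) to zero turns I'(β) into β^{d-1} (1 - β) ∫ b e^{-βf}. Since b
≥ 0, I increases up to β = 1 and decreases afterwards, so β = 1 is its maximum.

Neither finiteness nor the absence of a boundary term at infinity is known beforehand, so a cutoff
φ(f) at scale R is inserted; properness makes its support compact. The derivative gains the term -∫
φ'(f) a e^{-βf} ≥ 0 (`hasDerivAt_cutoffArea`). For β ≤ 1 its sign is favourable
(`cutoffArea_le_of_le_one`), and the resulting inequality itself forces integrability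
(`integrable_exp_of_cutoffArea_le`). With integrability in hand, the term is O(1/R) for β ≥ 1
(`cutoffArea_le_add_of_one_le`). Letting R → ∞ finishes.

The geometric input is `integral_shrinkerDiv`, the divergence theorem for u X^T, proved in charts
and globalized by a partition of unity; `sum_inner_mfderiv_tangentPart` computes the divergence. -/

noncomputable section

/-! ### Gram determinants and the divergence theorem in one coordinate patch -/

open Matrix in
/-- Jacobi's formula for the derivative of a determinant along a curve. -/
theorem hasDerivAt_det {ι : Type*} [Fintype ι] [DecidableEq ι] {A : ℝ → Matrix ι ι ℝ}
    {A' : Matrix ι ι ℝ} {s : ℝ} (hA : ∀ i j, HasDerivAt (fun r => A r i j) (A' i j) s) :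
    HasDerivAt (fun r => (A r).det) ((A s).adjugate * A').trace s := by
  have h1 : HasDerivAt (fun r => (A r).det)
      (∑ σ : Equiv.Perm ι, (Equiv.Perm.sign σ : ℝ) *
        ∑ j, (∏ i ∈ Finset.univ.erase j, A s (σ i) i) * A' (σ j) j) s := by
    simp only [det_apply']
    refine HasDerivAt.fun_sum fun σ _ => ?_
    refine HasDerivAt.const_mul _ ?_
    have := HasDerivAt.fun_finsetProd (u := Finset.univ) (f := fun i r => A r (σ i) i)
      (f' := fun i => A' (σ i) i) (x := s) (fun i _ => hA (σ i) i)
    simpa [smul_eq_mul] using this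
  convert h1 using 1
  have h2 : ((A s).adjugate * A').trace = ∑ j, ((A s).updateCol j (fun i => A' i j)).det := by
    simp only [trace, diag]
    refine Finset.sum_congr rfl fun j _ => ?_
    rw [← cramer_apply, cramer_eq_adjugate_mulVec]
    rfl
  rw [h2]
  simp only [det_apply', Finset.mul_sum]
  rw [Finset.sum_comm]
  refine Finset.sum_congr rfl fun σ _ => Finset.sum_congr rfl fun j _ => ?_
  congr 1
  rw [← Finset.mul_prod_erase _ _ (Finset.mem_univ j), mul_comm]
  congr 1
  · refine Finset.prod_congr rfl fun i hi => ?_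
    rw [updateCol_ne (Finset.ne_of_mem_erase hi)]
  · simp

theorem contDiffAt_det {ι E : Type*} [Fintype ι] [DecidableEq ι] [NormedAddCommGroup E]
    [NormedSpace ℝ E] {A : E → Matrix ι ι ℝ} {x : E} {r : WithTop ℕ∞}
    (hA : ∀ i j, ContDiffAt ℝ r (fun z => A z i j) x) :
    ContDiffAt ℝ r (fun z => (A z).det) x := by
  simp only [Matrix.det_apply']
  exact ContDiffAt.sum fun σ _ => contDiffAt_const.mul (contDiffAt_prod fun i _ => hA _ _)

/-- The `i`-th standard basis vector of `ℝ^n`. -/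
abbrev stdVec {n : ℕ} (i : Fin n) : Euc n := EuclideanSpace.single i (1 : ℝ)

theorem sum_smul_stdVec {n : ℕ} (v : Euc n) : ∑ i, v i • (stdVec i : Euc n) = v := by
  ext j
  simp [Pi.single_apply]

/-- The Gram matrix of the partial derivatives of `Y` at `y`. -/
def gramAt {n k : ℕ} (Y : Euc n → Euc k) (y : Euc n) : Matrix (Fin n) (Fin n) ℝ :=
  Matrix.gram ℝ fun i => fderiv ℝ Y y (stdVec i)

theorem gramAt_apply {n k : ℕ} (Y : Euc n → Euc k) (y : Euc n) (i j : Fin n) :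
    gramAt Y y i j = inner ℝ (fderiv ℝ Y y (stdVec i)) (fderiv ℝ Y y (stdVec j)) := rfl

theorem det_gramAt_pos {n k : ℕ} {Y : Euc n → Euc k} {y : Euc n}
    (h : Function.Injective (fderiv ℝ Y y)) : 0 < (gramAt Y y).det := by
  refine (Matrix.posDef_gram_of_linearIndependent ?_).det_pos
  have h1 : LinearIndependent ℝ (stdVec : Fin n → Euc n) := by
    have h2 : (stdVec : Fin n → Euc n) = (EuclideanSpace.basisFun (Fin n) ℝ).toBasis := by
      ext i : 1
      simp
    rw [h2]
    exact (EuclideanSpace.basisFun (Fin n) ℝ).toBasis.linearIndependent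
  exact h1.map' (fderiv ℝ Y y : Euc n →ₗ[ℝ] Euc k) (LinearMap.ker_eq_bot.2 h)

theorem contDiffAt_gramAt {n k : ℕ} {Y : Euc n → Euc k} {y : Euc n} (hY : ContDiffAt ℝ ∞ Y y)
    (i j : Fin n) : ContDiffAt ℝ ∞ (fun z => gramAt Y z i j) y := by
  have h : ContDiffAt ℝ ∞ (fderiv ℝ Y) y := hY.fderiv_right (m := ∞) (by simp)
  exact (h.clm_apply contDiffAt_const).inner ℝ (h.clm_apply contDiffAt_const)

theorem contDiffAt_sqrt_det_gramAt {n k : ℕ} {Y : Euc n → Euc k} {y : Euc n}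
    (hY : ContDiffAt ℝ ∞ Y y) (h : Function.Injective (fderiv ℝ Y y)) :
    ContDiffAt ℝ ∞ (fun z => √(gramAt Y z).det) y :=
  (contDiffAt_det (contDiffAt_gramAt hY)).sqrt (det_gramAt_pos h).ne'

/-- The matrix `⟨∂_i T, ∂_j Y⟩`. -/
def stressAt {n k : ℕ} (T Y : Euc n → Euc k) (y : Euc n) : Matrix (Fin n) (Fin n) ℝ :=
  Matrix.of fun i j => inner ℝ (fderiv ℝ T y (stdVec i)) (fderiv ℝ Y y (stdVec j))

theorem fderiv_gramAt {n k : ℕ} {Y : Euc n → Euc k} {y : Euc n} (hY : ContDiffAt ℝ ∞ Y y)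
    (v : Euc n) (i j : Fin n) :
    fderiv ℝ (fun z => gramAt Y z i j) y v =
      inner ℝ (fderiv ℝ (fderiv ℝ Y) y v (stdVec i)) (fderiv ℝ Y y (stdVec j)) +
      inner ℝ (fderiv ℝ Y y (stdVec i)) (fderiv ℝ (fderiv ℝ Y) y v (stdVec j)) := by
  have h : DifferentiableAt ℝ (fderiv ℝ Y) y :=
    (hY.fderiv_right (m := ∞) (by simp)).differentiableAt (by simp)
  have e (i : Fin n) : HasFDerivAt (fun z => fderiv ℝ Y z (stdVec i))
      ((fderiv ℝ (fderiv ℝ Y) y).flip (stdVec i)) y := by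
    simpa using h.hasFDerivAt.clm_apply (hasFDerivAt_const (stdVec i : Euc n) y)
  have h3 := ((e i).inner ℝ (e j)).fderiv
  have h4 : (fun z => gramAt Y z i j) =
    fun z => inner ℝ (fderiv ℝ Y z (stdVec i)) (fderiv ℝ Y z (stdVec j)) := rfl
  rw [h4, h3]
  simp [fderivInnerCLM_apply, add_comm]

open scoped Matrix in
-- By Jacobi's formula the logarithmic derivative of √det G along w is ½ tr(G⁻¹ dG(w)). With T =
-- dY(w), one has ∂_i T = D²Y(∂_i, w) + dY(∂_i w), so the matrix ⟨∂_i T, ∂_j Y⟩ is Q + JG with J the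
-- Jacobian of w. Since dG(w) = Q + Qᵀ and G is symmetric, half the trace is tr(G⁻¹Q), while JG
-- contributes the coordinate divergence tr J.
theorem fderiv_sqrt_det_gramAt {n k : ℕ} {Y : Euc n → Euc k} {y : Euc n} {w : Euc n → Euc n}
    (hY : ContDiffAt ℝ ∞ Y y) (hinj : Function.Injective (fderiv ℝ Y y))
    (hw : DifferentiableAt ℝ w y) :
    fderiv ℝ (fun z => √(gramAt Y z).det) y (w y) = √(gramAt Y y).det *
      (((gramAt Y y)⁻¹ * stressAt (fun z => fderiv ℝ Y z (w z)) Y y).trace -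
        ∑ i, fderiv ℝ w y (stdVec i) i) := by
  set G := gramAt Y y with hG
  have hpos : 0 < G.det := det_gramAt_pos hinj
  have hsymm : Gᵀ = G := by
    ext i j; simp only [Matrix.transpose_apply, hG, gramAt_apply, real_inner_comm]
  have hdet : fderiv ℝ (fun z => (gramAt Y z).det) y (w y) =
      (G.adjugate * Matrix.of fun i j => fderiv ℝ (fun z => gramAt Y z i j) y (w y)).trace := by
    have h1 (i j) : HasDerivAt (fun s : ℝ => gramAt Y (y + s • w y) i j)
        (fderiv ℝ (fun z => gramAt Y z i j) y (w y)) 0 :=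
      ((contDiffAt_gramAt hY i j).differentiableAt (by simp)).hasFDerivAt.hasLineDerivAt (w y)
    have h2 := hasDerivAt_det (A := fun s : ℝ => gramAt Y (y + s • w y))
      (A' := Matrix.of fun i j => fderiv ℝ (fun z => gramAt Y z i j) y (w y)) (s := 0) h1
    have h3 : HasDerivAt (fun s : ℝ => (gramAt Y (y + s • w y)).det)
        (fderiv ℝ (fun z => (gramAt Y z).det) y (w y)) 0 :=
      ((contDiffAt_det (contDiffAt_gramAt hY)).differentiableAt
        (by simp)).hasFDerivAt.hasLineDerivAt (w y)
    have h4 := h3.unique h2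
    simpa [hG] using h4
  have hsq : fderiv ℝ (fun z => √(gramAt Y z).det) y (w y) =
      1 / (2 * √G.det) * fderiv ℝ (fun z => (gramAt Y z).det) y (w y) := by
    have := (((contDiffAt_det (contDiffAt_gramAt hY)).differentiableAt
      (by simp)).hasFDerivAt.sqrt hpos.ne').fderiv
    rw [this]; simp [hG]
  set D2 := fderiv ℝ (fderiv ℝ Y) y with hD2
  have hd : DifferentiableAt ℝ (fderiv ℝ Y) y :=
    (hY.fderiv_right (m := ∞) (by simp)).differentiableAt (by simp)
  have hsecond (v v') : D2 v v' = D2 v' v :=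
    (hY.isSymmSndFDerivAt (by
    simpa using (by exact_mod_cast le_top : ((2 : ℕ∞) : WithTop ℕ∞) ≤ ∞))) v v'
  have hT (v) : fderiv ℝ (fun z => fderiv ℝ Y z (w z)) y v =
      D2 v (w y) + fderiv ℝ Y y (fderiv ℝ w y v) := by
    rw [(hd.hasFDerivAt.clm_apply hw.hasFDerivAt).fderiv]
    simp [hD2, add_comm]
  set Q : Matrix (Fin n) (Fin n) ℝ :=
    Matrix.of fun i j => inner ℝ (D2 (w y) (stdVec i)) (fderiv ℝ Y y (stdVec j)) with hQ
  set J : Matrix (Fin n) (Fin n) ℝ := Matrix.of fun i j => fderiv ℝ w y (stdVec i) j with hJ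
  have hS : stressAt (fun z => fderiv ℝ Y z (w z)) Y y = Q + J * G := by
    ext i j
    simp only [stressAt, Matrix.of_apply, Matrix.add_apply, hT, inner_add_left, hQ, hsecond,
      Matrix.mul_apply, hJ, hG, gramAt_apply]
    congr 1
    conv_lhs => rw [← sum_smul_stdVec (fderiv ℝ w y (stdVec i)), map_sum, sum_inner]
    simp [inner_smul_left]
  have hDG : (Matrix.of fun i j => fderiv ℝ (fun z => gramAt Y z i j) y (w y)) = Q + Qᵀ := by
    ext i j
    simp [fderiv_gramAt hY, hQ, hD2, real_inner_comm]
  have hunit : IsUnit G.det := hpos.ne'.isUnit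
  have hinv : G.adjugate = G.det • G⁻¹ := by
    rw [Matrix.inv_def, smul_smul, Ring.mul_inverse_cancel _ hunit, one_smul]
  have htr : (G⁻¹ * Qᵀ).trace = (G⁻¹ * Q).trace := by
    rw [← Matrix.trace_transpose, Matrix.transpose_mul, Matrix.transpose_transpose,
      Matrix.transpose_nonsing_inv, hsymm, Matrix.trace_mul_comm]
  have htr2 : (G⁻¹ * (J * G)).trace = ∑ i, fderiv ℝ w y (stdVec i) i := by
    rw [Matrix.trace_mul_comm, Matrix.mul_assoc, Matrix.mul_nonsing_inv _ hunit, Matrix.mul_one]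
    rfl
  rw [hsq, hdet, hDG, hinv, hS, Matrix.mul_add G⁻¹, Matrix.trace_add (G⁻¹ * Q), htr2,
    add_sub_cancel_right, Matrix.smul_mul, Matrix.trace_smul, Matrix.mul_add, Matrix.trace_add,
    htr, smul_eq_mul]
  have h0 : √G.det ≠ 0 := (Real.sqrt_pos.2 hpos).ne'
  have h1 : G.det = √G.det * √G.det := (Real.mul_self_sqrt hpos.le).symm
  field_simp
  rw [sq, ← h1]; ring

/-- The classical formula √g div(uw) = ∑ ∂_i(u √g w^i): the coordinate divergence of w cancels the
one in `fderiv_sqrt_det_gramAt`, leaving only the extrinsic trace. -/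
theorem sum_fderiv_mul_sqrt_det_gramAt {n k : ℕ} {Y : Euc n → Euc k} {y : Euc n}
    {w : Euc n → Euc n} {u : Euc n → ℝ} (hY : ContDiffAt ℝ ∞ Y y)
    (hinj : Function.Injective (fderiv ℝ Y y)) (hw : DifferentiableAt ℝ w y)
    (hu : DifferentiableAt ℝ u y) :
    ∑ i, fderiv ℝ (fun z => u z * √(gramAt Y z).det * w z i) y (stdVec i) =
      √(gramAt Y y).det * (fderiv ℝ u y (w y) +
        u y * ((gramAt Y y)⁻¹ * stressAt (fun z => fderiv ℝ Y z (w z)) Y y).trace) := by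
  have hq := ((contDiffAt_sqrt_det_gramAt hY hinj).differentiableAt (by simp))
  have hwi (i : Fin n) : HasFDerivAt (fun z => w z i)
      ((EuclideanSpace.proj i : Euc n →L[ℝ] ℝ).comp (fderiv ℝ w y)) y :=
    (EuclideanSpace.proj i : Euc n →L[ℝ] ℝ).hasFDerivAt.comp y hw.hasFDerivAt
  have h1 (i : Fin n) : fderiv ℝ (fun z => u z * √(gramAt Y z).det * w z i) y (stdVec i) =
      w y i • (√(gramAt Y y).det * fderiv ℝ u y (stdVec i)) +
      w y i • (u y * fderiv ℝ (fun z => √(gramAt Y z).det) y (stdVec i)) +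
      u y * √(gramAt Y y).det * fderiv ℝ w y (stdVec i) i := by
    have := ((hu.hasFDerivAt.fun_mul hq.hasFDerivAt).fun_mul (hwi i)).fderiv
    rw [this]
    simp; ring
  have h2 (L : Euc n →L[ℝ] ℝ) (c : ℝ) : ∑ i, w y i • (c * L (stdVec i)) = c * L (w y) := by
    conv_rhs => rw [← sum_smul_stdVec (w y), map_sum, Finset.mul_sum]
    simp; congr! 1; ring
  simp only [h1, Finset.sum_add_distrib, h2, ← Finset.mul_sum]
  rw [fderiv_sqrt_det_gramAt hY hinj hw]
  ring

theorem integral_fderiv_eq_zero {n : ℕ} {F : Euc n → ℝ} (hF : ContDiff ℝ 1 F)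
    (hc : HasCompactSupport F) (v : Euc n) :
    Integrable (fun y => fderiv ℝ F y v) ∧ ∫ y, fderiv ℝ F y v = 0 := by
  have hi : Integrable (fun y => fderiv ℝ F y v) :=
    ((hF.continuous_fderiv (by simp)).clm_apply continuous_const).integrable_of_hasCompactSupport
      (hc.fderiv_apply (𝕜 := ℝ) v)
  refine ⟨hi, ?_⟩
  have := integral_mul_fderiv_eq_neg_fderiv_mul_of_integrable (μ := (volume : Measure (Euc n)))
    (f := fun _ => (1 : ℝ)) (g := F) (v := v) (by simp) (by simpa using hi)
    (by simpa using hF.continuous.integrable_of_hasCompactSupport hc) (by simp)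
    (fun x _ => hF.differentiable (by simp) x)
  simpa using this

/-- The divergence theorem for the image of a vector field in an immersed coordinate patch. -/
theorem integral_tangential_divergence {n k : ℕ} {Y : Euc n → Euc k} {w : Euc n → Euc n}
    {u : Euc n → ℝ} {U K : Set (Euc n)} (hU : IsOpen U) (hK : IsCompact K) (hKU : K ⊆ U)
    (hY : ContDiffOn ℝ ∞ Y U) (hinj : ∀ y ∈ U, Function.Injective (fderiv ℝ Y y))
    (hw : ContDiffOn ℝ 1 w U) (hu : ContDiffOn ℝ 1 u U) (hu0 : ∀ y ∉ K, u y = 0) :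
    let Φ : Euc n → ℝ := fun y => √(gramAt Y y).det * (fderiv ℝ u y (w y) +
        u y * ((gramAt Y y)⁻¹ * stressAt (fun z => fderiv ℝ Y z (w z)) Y y).trace)
    IntegrableOn Φ U ∧ ∫ y in U, Φ y = 0 := by
  intro Φ
  -- `Y` and `w` are uncontrolled outside `U`, but `u` vanishes off the compact set `K ⊆ U`, so each
  -- `V i` is C¹ on the whole space.
  set V : Fin n → Euc n → ℝ := fun i z => u z * √(gramAt Y z).det * w z i with hV
  have hV0 (i) (y) (hy : y ∉ K) : V i y = 0 := by simp [hV, hu0 y hy]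
  have hVc (i) : ContDiff ℝ 1 (V i) := by
    rw [contDiff_iff_contDiffAt]
    intro y
    by_cases hy : y ∈ U
    · have hy' := hU.mem_nhds hy
      have h1 := (contDiffAt_sqrt_det_gramAt (hY.contDiffAt hy') (hinj y hy)).of_le
        (m := 1) (by simp)
      have h2 : ContDiffAt ℝ 1 (fun z => w z i) y :=
        (EuclideanSpace.proj i : Euc n →L[ℝ] ℝ).contDiff.contDiffAt.comp y (hw.contDiffAt hy')
      exact ((hu.contDiffAt hy').mul h1).mul h2
    · have hy' : Kᶜ ∈ nhds y := hK.isClosed.isOpen_compl.mem_nhds fun h => hy (hKU h)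
      refine (contDiffAt_const (c := (0 : ℝ))).congr_of_eventuallyEq ?_
      filter_upwards [hy'] with z hz using hV0 i z hz
  have hVs (i) : HasCompactSupport (V i) := HasCompactSupport.intro hK (hV0 i)
  have hsum : Set.EqOn Φ (fun y => ∑ i, fderiv ℝ (V i) y (stdVec i)) U := by
    intro y hy
    have hy' := hU.mem_nhds hy
    exact (sum_fderiv_mul_sqrt_det_gramAt (hY.contDiffAt hy') (hinj y hy)
      ((hw.contDiffAt hy').differentiableAt (by simp))
      ((hu.contDiffAt hy').differentiableAt (by simp))).symm
  have hint : Integrable (fun y => ∑ i, fderiv ℝ (V i) y (stdVec i)) :=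
    integrable_finsetSum _ fun i _ => (integral_fderiv_eq_zero (hVc i) (hVs i) _).1
  refine ⟨hint.integrableOn.congr_fun hsum.symm hU.measurableSet, ?_⟩
  rw [setIntegral_congr_fun hU.measurableSet hsum, setIntegral_eq_integral_of_forall_compl_eq_zero,
    integral_finsetSum _ fun i _ => (integral_fderiv_eq_zero (hVc i) (hVs i) _).1]
  · exact Finset.sum_eq_zero fun i _ => (integral_fderiv_eq_zero (hVc i) (hVs i) _).2
  · intro y hy
    refine Finset.sum_eq_zero fun i _ => ?_
    have hy' : Kᶜ ∈ nhds y := hK.isClosed.isOpen_compl.mem_nhds fun h => hy (hKU h)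
    have : V i =ᶠ[nhds y] fun _ => (0 : ℝ) := by
      filter_upwards [hy'] with z hz using hV0 i z hz
    rw [this.fderiv_eq]; simp

/-- The trace of a bilinear form over an orthonormal basis, computed in an arbitrary basis. -/
theorem sum_orthonormalBasis_eq_trace {E ι κ : Type*} [NormedAddCommGroup E]
    [InnerProductSpace ℝ E] [Fintype ι] [Fintype κ] [DecidableEq κ] (e : OrthonormalBasis ι ℝ E)
    (c : Module.Basis κ ℝ E) (β : E →ₗ[ℝ] E →ₗ[ℝ] ℝ) :
    ∑ a, β (e a) (e a) = ((Matrix.gram ℝ c)⁻¹ * Matrix.of fun i j => β (c i) (c j)).trace := by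
  classical
  -- C and K are the two change-of-basis matrices, inverse to each other. Then G = CCᵀ and the
  -- matrix of β in the basis c is CBCᵀ, so tr(G⁻¹ CBCᵀ) = tr(KᵀK CBCᵀ) = tr B.
  set C : Matrix κ ι ℝ := Matrix.of fun i a => inner ℝ (e a) (c i) with hC
  set K : Matrix ι κ ℝ := Matrix.of fun a i => c.repr (e a) i with hK
  set B : Matrix ι ι ℝ := Matrix.of fun a b => β (e a) (e b) with hB
  have hc (i) : c i = ∑ a, C i a • e a := (e.sum_repr' (c i)).symm
  have he (a) : e a = ∑ i, K a i • c i := (c.sum_repr (e a)).symm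
  have hCK : C * K = 1 := by
    ext i j
    have h := congrArg (fun v => c.repr v j) (hc i)
    simp only [map_sum, map_smul, Finsupp.coe_finsetSum, Finset.sum_apply, Finsupp.smul_apply,
      Module.Basis.repr_self, smul_eq_mul] at h
    rw [Matrix.mul_apply, Matrix.one_apply]
    rw [Finsupp.single_apply] at h
    exact h.symm
  have hKC : K * C = 1 := by
    ext a b
    have h := congrArg (fun v => inner ℝ (e b) v) (he a)
    simp only [inner_sum, inner_smul_right] at h
    rw [Matrix.mul_apply, Matrix.one_apply]
    rw [orthonormal_iff_ite.1 e.orthonormal b a] at h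
    simp only [eq_comm (a := b)] at h
    exact h.symm
  have hG : Matrix.gram ℝ c = C * C.transpose := by
    ext i j
    rw [Matrix.gram_apply, ← e.sum_inner_mul_inner (c i) (c j), Matrix.mul_apply]
    refine Finset.sum_congr rfl fun a _ => ?_
    simp [hC, real_inner_comm]
  have hinv : (Matrix.gram ℝ c)⁻¹ = K.transpose * K := by
    refine Matrix.inv_eq_right_inv ?_
    rw [hG, Matrix.mul_assoc, ← Matrix.mul_assoc C.transpose, ← Matrix.transpose_mul, hKC,
      Matrix.transpose_one, Matrix.one_mul, hCK]
  have hS : (Matrix.of fun i j => β (c i) (c j)) = C * B * C.transpose := by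
    ext i j
    rw [Matrix.of_apply, hc i, hc j]
    simp only [map_sum, map_smul, LinearMap.sum_apply, LinearMap.smul_apply, Matrix.mul_apply,
      Matrix.transpose_apply, hB, Matrix.of_apply, smul_eq_mul, Finset.sum_mul, Finset.mul_sum]
    refine Finset.sum_congr rfl fun a _ => Finset.sum_congr rfl fun b _ => ?_
    ring
  rw [hinv, hS, Matrix.mul_assoc, ← Matrix.mul_assoc K, ← Matrix.mul_assoc K, hKC, Matrix.one_mul,
    Matrix.trace_mul_comm, Matrix.mul_assoc, ← Matrix.transpose_mul, hKC, Matrix.transpose_one,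
    Matrix.mul_one]
  rfl

/-! ### The immersion read in charts -/

section Immersion

variable {n k : ℕ} {M : Type*} [TopologicalSpace M] [ChartedSpace (Euc n) M]

theorem contDiffOn_comp_symm [IsManifold (𝓡 n) ∞ M] {F : Type*} [NormedAddCommGroup F]
    [NormedSpace ℝ F] {f : M → F} (hf : ContMDiff (𝓡 n) 𝓘(ℝ, F) ∞ f)
    {e : OpenPartialHomeomorph M (Euc n)} (he : e ∈ atlas (Euc n) M) :
    ContDiffOn ℝ ∞ (f ∘ e.symm) e.target := by
  rw [← contMDiffOn_iff_contDiffOn]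
  exact hf.comp_contMDiffOn
    (contMDiffOn_symm_of_mem_maximalAtlas (IsManifold.subset_maximalAtlas he))

theorem fderiv_comp_symm [IsManifold (𝓡 n) ∞ M] {F : Type*} [NormedAddCommGroup F]
    [NormedSpace ℝ F] {f : M → F} {e : OpenPartialHomeomorph M (Euc n)}
    (he : e ∈ atlas (Euc n) M) {y : Euc n} (hy : y ∈ e.target)
    (hf : MDifferentiableAt (𝓡 n) 𝓘(ℝ, F) f (e.symm y)) (v : Euc n) :
    fderiv ℝ (f ∘ e.symm) y v =
      mfderiv (𝓡 n) 𝓘(ℝ, F) f (e.symm y) (mfderiv (𝓡 n) (𝓡 n) e.symm y v) := by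
  have : IsManifold (𝓡 n) 1 M := IsManifold.of_le (n := ∞) (by simp)
  rw [← mfderiv_eq_fderiv, mfderiv_comp y hf (mdifferentiableAt_atlas_symm he hy)]
  rfl

theorem mfderiv_symm_bijective [IsManifold (𝓡 n) ∞ M] {e : OpenPartialHomeomorph M (Euc n)}
    (he : e ∈ atlas (Euc n) M) {y : Euc n} (hy : y ∈ e.target) :
    Function.Bijective (mfderiv (𝓡 n) (𝓡 n) e.symm y) := by
  have : IsManifold (𝓡 n) 1 M := IsManifold.of_le (n := ∞) (by simp)
  exact (mdifferentiable_of_mem_atlas (I := 𝓡 n) he).symm.mfderiv_bijective (x := y) hy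

/-- The basis of coordinate vector fields of the chart `e`. -/
def coordBasis [IsManifold (𝓡 n) ∞ M]
    {e : OpenPartialHomeomorph M (Euc n)} (he : e ∈ atlas (Euc n) M) {y : Euc n}
    (hy : y ∈ e.target) : Module.Basis (Fin n) ℝ (TangentSpace (𝓡 n) (e.symm y)) :=
  Module.Basis.map (M := TangentSpace (𝓡 n) y) (EuclideanSpace.basisFun (Fin n) ℝ).toBasis
    (LinearEquiv.ofBijective (mfderiv (𝓡 n) (𝓡 n) e.symm y).toLinearMap
      (mfderiv_symm_bijective he hy))

theorem coordBasis_apply [IsManifold (𝓡 n) ∞ M]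
    {e : OpenPartialHomeomorph M (Euc n)} (he : e ∈ atlas (Euc n) M)
    {y : Euc n} (hy : y ∈ e.target) (i : Fin n) :
    coordBasis he hy i = mfderiv (𝓡 n) (𝓡 n) e.symm y (stdVec i : Euc n) := by
  have h : (EuclideanSpace.basisFun (Fin n) ℝ).toBasis i = stdVec i := by simp
  rw [← h]
  exact Module.Basis.map_apply ..

theorem mfderiv_eq_fderiv_chartAt {F : Type*} [NormedAddCommGroup F] [NormedSpace ℝ F] {f : M → F}
    {p : M} (hf : MDifferentiableAt (𝓡 n) 𝓘(ℝ, F) f p) (v : TangentSpace (𝓡 n) p) :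
    mfderiv (𝓡 n) 𝓘(ℝ, F) f p v =
      fderiv ℝ (f ∘ (chartAt (Euc n) p).symm) (chartAt (Euc n) p p) (show Euc n from v) := by
  rw [hf.mfderiv]
  simp [writtenInExtChartAt, extChartAt, fderivWithin_univ]
  rfl

variable [RiemannianBundle (fun p : M => TangentSpace (𝓡 n) p)]

theorem IsIsometricImmersion.mdifferentiableAt {X : M → Euc k} (hX : IsIsometricImmersion n X)
    (p : M) : MDifferentiableAt (𝓡 n) 𝓘(ℝ, Euc k) X p :=
  hX.1.mdifferentiable (by simp) p

theorem IsIsometricImmersion.injective {X : M → Euc k} (hX : IsIsometricImmersion n X)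
    (p : M) : Function.Injective (differential n X p) := by
  rw [injective_iff_map_eq_zero]
  intro v hv
  have := hX.2 p v v
  rw [hv, inner_zero_left] at this
  exact inner_self_eq_zero.1 this.symm

theorem IsIsometricImmersion.injective_fderiv [IsManifold (𝓡 n) ∞ M] {X : M → Euc k}
    (hX : IsIsometricImmersion n X)
    {e : OpenPartialHomeomorph M (Euc n)} (he : e ∈ atlas (Euc n) M) {y : Euc n}
    (hy : y ∈ e.target) : Function.Injective (fderiv ℝ (X ∘ e.symm) y) := by
  intro v w h
  rw [fderiv_comp_symm he hy (hX.mdifferentiableAt _),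
    fderiv_comp_symm he hy (hX.mdifferentiableAt _)] at h
  exact (mfderiv_symm_bijective he hy).1 (hX.injective _ h)

theorem IsIsometricImmersion.metricMatrix_eq [IsManifold (𝓡 n) ∞ M] {X : M → Euc k}
    (hX : IsIsometricImmersion n X)
    {e : OpenPartialHomeomorph M (Euc n)} (he : e ∈ atlas (Euc n) M) {y : Euc n}
    (hy : y ∈ e.target) : metricMatrix e y = gramAt (X ∘ e.symm) y := by
  ext i j
  rw [gramAt_apply, fderiv_comp_symm he hy (hX.mdifferentiableAt _),
    fderiv_comp_symm he hy (hX.mdifferentiableAt _)]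
  exact (hX.2 _ _ _).symm

end Immersion

/-! ### Tangential and normal parts of the position vector, and the divergence of X^T -/

section Coordinates

variable {n k : ℕ}

/-- The coordinates of the tangential part of the position vector of an immersed patch. -/
def tangentCoord (Y : Euc n → Euc k) (y : Euc n) : Euc n :=
  WithLp.toLp 2 fun i => (gramAt Y y).det⁻¹ *
    ((gramAt Y y).updateCol i fun j => inner ℝ (fderiv ℝ Y y (stdVec j)) (Y y)).det

/-- Cramer's rule: `tangentCoord` solves the normal equations Gc = (⟨∂_j Y, Y⟩)_j. The explicit
determinants also make its smoothness immediate. -/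
theorem inner_sub_tangentCoord {Y : Euc n → Euc k} {y : Euc n}
    (hinj : Function.Injective (fderiv ℝ Y y)) (v : Euc n) :
    inner ℝ (Y y - fderiv ℝ Y y (tangentCoord Y y)) (fderiv ℝ Y y v) = 0 := by
  set G := gramAt Y y with hG
  set b : Fin n → ℝ := fun j => inner ℝ (fderiv ℝ Y y (stdVec j)) (Y y) with hb
  have hdet : G.det ≠ 0 := (det_gramAt_pos hinj).ne'
  have h1 (j : Fin n) :
      inner ℝ (Y y - fderiv ℝ Y y (tangentCoord Y y)) (fderiv ℝ Y y (stdVec j)) = 0 := by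
    have h2 := congrFun (Matrix.mulVec_cramer G b) j
    simp only [Matrix.mulVec, dotProduct, Matrix.cramer_apply, Pi.smul_apply, smul_eq_mul] at h2
    have h3 : inner ℝ (fderiv ℝ Y y (tangentCoord Y y)) (fderiv ℝ Y y (stdVec j)) = b j := by
      rw [← sum_smul_stdVec (tangentCoord Y y), map_sum, sum_inner]
      have h4 (i : Fin n) : inner ℝ (fderiv ℝ Y y (tangentCoord Y y i • stdVec i))
          (fderiv ℝ Y y (stdVec j)) = G.det⁻¹ * (G j i * (G.updateCol i b).det) := by
        rw [map_smul, inner_smul_left, hG, gramAt_apply, real_inner_comm]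
        simp only [tangentCoord, conj_trivial, hb]
        ring
      simp only [h4, ← Finset.mul_sum, h2]
      rw [inv_mul_cancel_left₀ hdet]
    rw [inner_sub_left, h3, hb, real_inner_comm, sub_self]
  rw [← sum_smul_stdVec v, map_sum, inner_sum]
  simp [inner_smul_right, h1]

theorem contDiffAt_tangentCoord {Y : Euc n → Euc k} {y : Euc n} (hY : ContDiffAt ℝ ∞ Y y)
    (hinj : Function.Injective (fderiv ℝ Y y)) : ContDiffAt ℝ ∞ (tangentCoord Y) y := by
  rw [contDiffAt_euclidean]
  intro i
  have hG := contDiffAt_gramAt hY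
  have hD : ContDiffAt ℝ ∞ (fderiv ℝ Y) y := hY.fderiv_right (m := ∞) (by simp)
  refine ((contDiffAt_det hG).inv (det_gramAt_pos hinj).ne').mul (contDiffAt_det fun j l => ?_)
  by_cases h : l = i
  · subst h
    simpa using (hD.clm_apply contDiffAt_const).inner ℝ hY
  · simpa [Matrix.updateCol_ne h] using hG j l

/-- Differentiate ⟨N, dY(w)⟩ = 0 in the direction v, with w constant. -/
theorem inner_fderiv_fderiv_of_orthogonal {Y N : Euc n → Euc k} {y : Euc n}
    (hN : DifferentiableAt ℝ N y) (hY : DifferentiableAt ℝ (fderiv ℝ Y) y) (v w : Euc n)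
    (h : (fun z => inner ℝ (N z) (fderiv ℝ Y z w)) =ᶠ[nhds y] fun _ => (0 : ℝ)) :
    inner ℝ (N y) (fderiv ℝ (fderiv ℝ Y) y v w) =
      -inner ℝ (fderiv ℝ N y v) (fderiv ℝ Y y w) := by
  have h1 := h.fderiv_eq (𝕜 := ℝ)
  have h2 := (hN.hasFDerivAt.inner ℝ
    (hY.hasFDerivAt.clm_apply (hasFDerivAt_const w y))).fderiv
  rw [h1] at h2
  have h3 := DFunLike.congr_fun h2 v
  simp [fderivInnerCLM_apply] at h3
  linarith

end Coordinates

section Immersion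

variable {n k : ℕ} {M : Type*} [TopologicalSpace M] [ChartedSpace (Euc n) M]

variable (n) in
/-- The tangential part of the position vector. -/
def tangentPart (X : M → Euc k) (p : M) : Euc k :=
  (tangentPlane n X p).starProjection (X p)

theorem tangentPart_add_normalPart (X : M → Euc k) (p : M) :
    tangentPart n X p + normalPart n X p (X p) = X p :=
  Submodule.starProjection_add_starProjection_orthogonal _

theorem inner_normalPart_differential (X : M → Euc k) (p : M) (x : Euc k)
    (v : TangentSpace (𝓡 n) p) : inner ℝ (normalPart n X p x) (differential n X p v) = 0 :=
  Submodule.inner_left_of_mem_orthogonal (K := tangentPlane n X p) ⟨v, rfl⟩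
    (Submodule.starProjection_apply_mem _ _)

variable (n) in
theorem exists_differential_eq_tangentPart (X : M → Euc k) (p : M) :
    ∃ v, differential n X p v = tangentPart n X p :=
  (Submodule.starProjection_apply_mem (tangentPlane n X p) (X p))

variable (n) in
/-- The tangential part of the position vector, as a tangent vector. -/
def positionField (X : M → Euc k) (p : M) : TangentSpace (𝓡 n) p :=
  (exists_differential_eq_tangentPart n X p).choose

theorem differential_positionField (X : M → Euc k) (p : M) :
    differential n X p (positionField n X p) = tangentPart n X p :=
  (exists_differential_eq_tangentPart n X p).choose_spec

variable [RiemannianBundle (fun p : M => TangentSpace (𝓡 n) p)] [IsManifold (𝓡 n) ∞ M]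
  {X : M → Euc k} {e : OpenPartialHomeomorph M (Euc n)}

theorem fderiv_tangentCoord (hX : IsIsometricImmersion n X) (he : e ∈ atlas (Euc n) M)
    {y : Euc n} (hy : y ∈ e.target) :
    fderiv ℝ (X ∘ e.symm) y (tangentCoord (X ∘ e.symm) y) = tangentPart n X (e.symm y) := by
  have hm := hX.mdifferentiableAt (e.symm y)
  refine (Submodule.eq_starProjection_of_mem_of_inner_eq_zero ?_ ?_).symm
  · exact ⟨_, (fderiv_comp_symm he hy hm _).symm⟩
  · rintro _ ⟨v, rfl⟩
    obtain ⟨v', rfl⟩ := (mfderiv_symm_bijective he hy).2 v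
    have := inner_sub_tangentCoord (hX.injective_fderiv he hy) v'
    rw [fderiv_comp_symm he hy hm v'] at this
    exact this

theorem mfderiv_symm_tangentCoord (hX : IsIsometricImmersion n X) (he : e ∈ atlas (Euc n) M)
    {y : Euc n} (hy : y ∈ e.target) :
    mfderiv (𝓡 n) (𝓡 n) e.symm y (tangentCoord (X ∘ e.symm) y) =
      positionField n X (e.symm y) := by
  apply hX.injective
  rw [differential_positionField, ← fderiv_tangentCoord hX he hy,
    fderiv_comp_symm he hy (hX.mdifferentiableAt _)]
  rfl

theorem contDiffOn_tangentCoord (hX : IsIsometricImmersion n X) (he : e ∈ atlas (Euc n) M) :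
    ContDiffOn ℝ ∞ (tangentCoord (X ∘ e.symm)) e.target := fun _ hy =>
  (contDiffAt_tangentCoord ((contDiffOn_comp_symm hX.1 he).contDiffAt
    (e.open_target.mem_nhds hy)) (hX.injective_fderiv he hy)).contDiffWithinAt

/-- The projection is defined pointwise, so its regularity is read off the local formula
dY(`tangentCoord` Y). -/
theorem mdifferentiableAt_tangentPart (hX : IsIsometricImmersion n X) (p : M) :
    MDifferentiableAt (𝓡 n) 𝓘(ℝ, Euc k) (tangentPart n X) p := by
  have : IsManifold (𝓡 n) 1 M := IsManifold.of_le (n := ∞) (by simp)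
  set e := chartAt (Euc n) p with he'
  have he : e ∈ atlas (Euc n) M := chart_mem_atlas _ p
  have hp : p ∈ e.source := mem_chart_source _ p
  have hy := e.map_source hp
  have hY := (contDiffOn_comp_symm hX.1 he).contDiffAt (e.open_target.mem_nhds hy)
  have h1 : DifferentiableAt ℝ
      (fun y => fderiv ℝ (X ∘ e.symm) y (tangentCoord (X ∘ e.symm) y)) (e p) :=
    ((hY.fderiv_right (m := ∞) (by simp)).clm_apply (contDiffAt_tangentCoord hY
      (hX.injective_fderiv he hy))).differentiableAt (by simp)
  have h2 := h1.mdifferentiableAt.comp p (mdifferentiableAt_atlas (I := 𝓡 n) he hp)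
  refine h2.congr_of_eventuallyEq ?_
  filter_upwards [e.open_source.mem_nhds hp] with q hq
  simp only [Function.comp_apply]
  rw [fderiv_tangentCoord hX he (e.map_source hq), e.left_inv hq]

theorem mdifferentiableAt_normalPart (hX : IsIsometricImmersion n X) (p : M) :
    MDifferentiableAt (𝓡 n) 𝓘(ℝ, Euc k) (fun q => normalPart n X q (X q)) p := by
  have : (fun q => normalPart n X q (X q)) = fun q => X q - tangentPart n X q := by
    funext q
    exact eq_sub_of_add_eq' (tangentPart_add_normalPart X q)
  rw [this]
  exact (hX.mdifferentiableAt p).sub (mdifferentiableAt_tangentPart hX p)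

/-- The Weingarten equation for the normal part of the position vector. -/
theorem inner_secondFundamentalForm (hX : IsIsometricImmersion n X) (p : M)
    (v w : TangentSpace (𝓡 n) p) :
    inner ℝ (normalPart n X p (X p)) (secondFundamentalForm n X p v w) =
      -inner ℝ (differential n (fun q => normalPart n X q (X q)) p v)
        (differential n X p w) := by
  set e := chartAt (Euc n) p with he'
  have he : e ∈ atlas (Euc n) M := chart_mem_atlas _ p
  have hp : p ∈ e.source := mem_chart_source _ p
  have hy := e.map_source hp
  set N : M → Euc k := fun q => normalPart n X q (X q) with hN
  have hNd := mdifferentiableAt_normalPart hX p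
  have hY := (contDiffOn_comp_symm hX.1 he).contDiffAt (e.open_target.mem_nhds hy)
  have hDY : DifferentiableAt ℝ (fderiv ℝ (X ∘ e.symm)) (e p) :=
    (hY.fderiv_right (m := ∞) (by simp)).differentiableAt (by simp)
  have hNe : DifferentiableAt ℝ (N ∘ e.symm) (e p) := by
    have : IsManifold (𝓡 n) 1 M := IsManifold.of_le (n := ∞) (by simp)
    rw [← mdifferentiableAt_iff_differentiableAt]
    refine MDifferentiableAt.comp (e p) ?_ (mdifferentiableAt_atlas_symm he hy)
    rw [e.left_inv hp]
    exact hNd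
  have hzero : (fun z => inner ℝ ((N ∘ e.symm) z)
      (fderiv ℝ (X ∘ e.symm) z (show Euc n from w))) =ᶠ[nhds (e p)] fun _ => (0 : ℝ) := by
    filter_upwards [e.open_target.mem_nhds hy] with z hz
    rw [fderiv_comp_symm he hz (hX.mdifferentiableAt _)]
    exact inner_normalPart_differential X _ _ _
  have h3 := inner_fderiv_fderiv_of_orthogonal hNe hDY (show Euc n from v) _ hzero
  have h5 : (N ∘ e.symm) (e p) = N p := congrArg N (e.left_inv hp)
  rw [h5] at h3
  -- The vector paired with B is already normal, so the projection inside B can be dropped.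
  have h4 : inner ℝ (N p) (secondFundamentalForm n X p v w) =
      inner ℝ (N p) (fderiv ℝ (fderiv ℝ (X ∘ e.symm)) (e p) (show Euc n from v)
        (show Euc n from w)) := by
    rw [secondFundamentalForm, normalPart, ← Submodule.inner_starProjection_left_eq_right]
    congr 1
    exact Submodule.starProjection_eq_self_iff.2 (Submodule.starProjection_apply_mem _ _)
  exact (h4.trans h3).trans (congrArg₂ (fun a b : Euc k => -inner ℝ a b)
    (mfderiv_eq_fderiv_chartAt hNd v).symm
    (mfderiv_eq_fderiv_chartAt (hX.mdifferentiableAt p) w).symm)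

/-- The divergence of the tangential part of the position vector of a self-shrinker. -/
theorem sum_inner_mfderiv_tangentPart (hX : IsIsometricImmersion n X) (hs : IsSelfShrinker n X)
    (p : M) :
    ∑ a, inner ℝ (differential n (tangentPart n X) p
        (stdOrthonormalBasis ℝ (TangentSpace (𝓡 n) p) a))
      (differential n X p (stdOrthonormalBasis ℝ (TangentSpace (𝓡 n) p) a)) =
    n - ‖normalPart n X p (X p)‖ ^ 2 / 2 := by
  set N : M → Euc k := fun q => normalPart n X q (X q) with hN
  set b := stdOrthonormalBasis ℝ (TangentSpace (𝓡 n) p)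
  have hsum (v) : (differential n (tangentPart n X) p v) +
      (differential n N p v) = differential n X p v := by
    have h := ((mdifferentiableAt_tangentPart hX p).hasMFDerivAt.add
      (mdifferentiableAt_normalPart hX p).hasMFDerivAt).mfderiv
    have h' : tangentPart n X + N = X := funext fun q => tangentPart_add_normalPart X q
    rw [h'] at h
    exact (congrArg (fun L : TangentSpace (𝓡 n) p →L[ℝ] Euc k => L v) h).symm
  -- From X^T = X - N and the Weingarten equation; summing over the basis produces n + ⟨N, H⟩, where
  -- the shrinker equation applies.
  have h1 (a) : inner ℝ (differential n (tangentPart n X) p (b a))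
      (differential n X p (b a)) = 1 + inner ℝ (N p) (secondFundamentalForm n X p (b a) (b a)) := by
    rw [inner_secondFundamentalForm hX]
    have h3 : inner ℝ (differential n X p (b a)) (differential n X p (b a)) = (1 : ℝ) := by
      rw [hX.2, real_inner_self_eq_norm_sq, b.norm_eq_one]; norm_num
    have h4 : inner ℝ (differential n (tangentPart n X) p (b a))
        (differential n X p (b a)) + inner ℝ (differential n N p (b a))
        (differential n X p (b a)) = 1 := by
      rw [← inner_add_left, hsum, h3]
    linarith
  simp only [h1, Finset.sum_add_distrib, ← inner_sum]
  have h5 : ∑ a, secondFundamentalForm n X p (b a) (b a) = meanCurvature n X p := rfl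
  have h6 : Module.finrank ℝ (TangentSpace (𝓡 n) p) = n := by
    have : Module.finrank ℝ (Euc n) = n := by simp
    exact this
  rw [h5, hs p, inner_smul_right, real_inner_self_eq_norm_sq]
  simp [h6, hN]
  ring

end Immersion

/-! ### The Riemannian volume and its independence of charts -/

/-- The Gram matrix transforms as JᵀGJ with J the Jacobian of φ. -/
theorem det_gramAt_comp {n k : ℕ} {Y : Euc n → Euc k} {φ : Euc n → Euc n} {y : Euc n}
    (hY : DifferentiableAt ℝ Y (φ y)) (hφ : DifferentiableAt ℝ φ y) :
    (gramAt (Y ∘ φ) y).det = (fderiv ℝ φ y).det ^ 2 * (gramAt Y (φ y)).det := by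
  set b := (EuclideanSpace.basisFun (Fin n) ℝ).toBasis
  set J := LinearMap.toMatrix b b (fderiv ℝ φ y : Euc n →ₗ[ℝ] Euc n) with hJ
  have hJa (i j) : J i j = fderiv ℝ φ y (stdVec j) i := by
    simp [hJ, LinearMap.toMatrix_apply, b]
  have h : gramAt (Y ∘ φ) y = J.transpose * gramAt Y (φ y) * J := by
    ext i j
    have h1 (i) : fderiv ℝ (Y ∘ φ) y (stdVec i) =
        ∑ l, J l i • fderiv ℝ Y (φ y) (stdVec l) := by
      rw [fderiv_comp y hY hφ, ContinuousLinearMap.comp_apply,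
        ← sum_smul_stdVec (fderiv ℝ φ y (stdVec i)), map_sum]
      simp [hJa]
    rw [gramAt_apply, h1, h1, inner_sum]
    simp only [sum_inner, Matrix.mul_apply, inner_smul_left, inner_smul_right, conj_trivial,
      Matrix.transpose_apply, gramAt_apply, Finset.sum_mul, Finset.mul_sum]
    refine Finset.sum_congr rfl fun a _ => Finset.sum_congr rfl fun c _ => ?_
    ring
  have hdet : J.det = (fderiv ℝ φ y).det := LinearMap.det_toMatrix _ _
  rw [h, Matrix.det_mul, Matrix.det_mul, Matrix.det_transpose, hdet]
  ring

theorem aemeasurable_symm {n : ℕ} {M : Type*} [TopologicalSpace M] [MeasurableSpace M]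
    [BorelSpace M] (e : OpenPartialHomeomorph M (Euc n)) :
    AEMeasurable e.symm (volume.restrict e.target) :=
  e.continuousOn_symm.aemeasurable e.open_target.measurableSet

theorem measurableSet_target_inter {n : ℕ} {M : Type*} [TopologicalSpace M] [MeasurableSpace M]
    [BorelSpace M] (e : OpenPartialHomeomorph M (Euc n)) {A : Set M}
    (hA : MeasurableSet A) : MeasurableSet (e.target ∩ e.symm ⁻¹' A) := by
  have h1 : Measurable (e.target.domRestrict e.symm) := e.continuousOn_symm.domRestrict.measurable
  have h2 := e.open_target.measurableSet.subtype_image (h1 hA)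
  convert h2 using 1
  ext y
  simp [and_comm]

section Volume

variable {n k : ℕ} {M : Type*} [TopologicalSpace M] [ChartedSpace (Euc n) M]
  [RiemannianBundle (fun p : M => TangentSpace (𝓡 n) p)]
  {X : M → Euc k} {e e' : OpenPartialHomeomorph M (Euc n)}

theorem chartVolume_le_riemannianVolume [MeasurableSpace M] (he : e ∈ atlas (Euc n) M) :
    chartVolume e ≤ riemannianVolume n M :=
  le_iSup₂_of_le e he le_rfl

theorem chartVolume_apply [MeasurableSpace M] [BorelSpace M]
    (e : OpenPartialHomeomorph M (Euc n)) {A : Set M}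
    (hA : MeasurableSet A) : chartVolume e A =
      ∫⁻ y in e.target ∩ e.symm ⁻¹' A, ENNReal.ofReal √(metricMatrix e y).det := by
  rw [chartVolume, Measure.map_apply_of_aemeasurable
    ((aemeasurable_symm e).mono_ac (withDensity_absolutelyContinuous _ _)) hA,
    withDensity_apply', Measure.restrict_restrict' e.open_target.measurableSet, Set.inter_comm]

theorem chartVolume_compl_source [MeasurableSpace M] [BorelSpace M]
    (e : OpenPartialHomeomorph M (Euc n)) :
    chartVolume e e.sourceᶜ = 0 := by
  rw [chartVolume_apply e e.open_source.measurableSet.compl]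
  have : e.target ∩ e.symm ⁻¹' e.sourceᶜ = ∅ := by
    ext y
    simp only [Set.mem_inter_iff, Set.mem_preimage, Set.mem_compl_iff, Set.mem_empty_iff_false,
      iff_false, not_and, not_not]
    exact fun hy => e.map_target hy
  rw [this, Measure.restrict_empty, lintegral_zero_measure]

variable [IsManifold (𝓡 n) ∞ M]

theorem continuousOn_sqrt_det_metricMatrix (hX : IsIsometricImmersion n X)
    (he : e ∈ atlas (Euc n) M) : ContinuousOn (fun y => √(metricMatrix e y).det) e.target := by
  refine ContinuousOn.congr (f := fun y => √(gramAt (X ∘ e.symm) y).det) (fun y hy => ?_)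
    fun y hy => by rw [hX.metricMatrix_eq he hy]
  exact (contDiffAt_sqrt_det_gramAt ((contDiffOn_comp_symm hX.1 he).contDiffAt
    (e.open_target.mem_nhds hy)) (hX.injective_fderiv he hy)).continuousAt.continuousWithinAt

variable [MeasurableSpace M] [BorelSpace M]

/-- The Riemannian volumes of two charts agree where both are defined. -/
theorem chartVolume_eq_chartVolume (hX : IsIsometricImmersion n X) (he : e ∈ atlas (Euc n) M)
    (he' : e' ∈ atlas (Euc n) M) {A : Set M} (hA : MeasurableSet A) (hAe : A ⊆ e.source)
    (hAe' : A ⊆ e'.source) : chartVolume e A = chartVolume e' A := by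
  set B := e.target ∩ e.symm ⁻¹' A with hB
  set φ : Euc n → Euc n := e' ∘ e.symm with hφ
  have hφd {y} (hy : y ∈ B) : DifferentiableAt ℝ φ y := by
    have : IsManifold (𝓡 n) 1 M := IsManifold.of_le (n := ∞) (by simp)
    rw [← mdifferentiableAt_iff_differentiableAt]
    exact (mdifferentiableAt_atlas he' (hAe' hy.2)).comp y (mdifferentiableAt_atlas_symm he hy.1)
  have himg : φ '' B = e'.target ∩ e'.symm ⁻¹' A := by
    ext z
    constructor
    · rintro ⟨y, hy, rfl⟩
      refine ⟨e'.map_source (hAe' hy.2), ?_⟩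
      simp only [hφ, Set.mem_preimage, Function.comp_apply]
      rw [e'.left_inv (hAe' hy.2)]
      exact hy.2
    · rintro ⟨hz, hzA⟩
      refine ⟨e (e'.symm z), ⟨e.map_source (hAe hzA), ?_⟩, ?_⟩
      · rw [Set.mem_preimage, e.left_inv (hAe hzA)]
        exact hzA
      · simp only [hφ, Function.comp_apply]
        rw [e.left_inv (hAe hzA), e'.right_inv hz]
  have hinj : Set.InjOn φ B := fun y hy z hz h =>
    e.symm.injOn hy.1 hz.1 (e'.injOn (hAe' hy.2) (hAe' hz.2) h)
  -- Change of variables along the transition map φ; its factor |det dφ| is exactly the ratio of the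
  -- two densities, by `det_gramAt_comp`.
  rw [chartVolume_apply e hA, chartVolume_apply e' hA, ← himg,
    lintegral_image_eq_lintegral_abs_det_fderiv_mul volume (measurableSet_target_inter e hA)
      (fun y hy => (hφd hy).hasFDerivAt.hasFDerivWithinAt) hinj]
  refine setLIntegral_congr_fun (measurableSet_target_inter e hA) fun y hy => ?_
  have hφy : φ y ∈ e'.target := e'.map_source (hAe' hy.2)
  have hYd := ((contDiffOn_comp_symm hX.1 he').contDiffAt
    (e'.open_target.mem_nhds hφy)).differentiableAt (by simp)
  have hev : X ∘ e.symm =ᶠ[nhds y] (X ∘ e'.symm) ∘ φ := by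
    filter_upwards [(e.symm.isOpen_inter_preimage e'.open_source).mem_nhds ⟨hy.1, hAe' hy.2⟩]
      with z hz
    exact (congrArg X (e'.left_inv hz.2)).symm
  have hgram : gramAt (X ∘ e.symm) y = gramAt ((X ∘ e'.symm) ∘ φ) y := by
    simp only [gramAt, hev.fderiv_eq]
  simp only [hX.metricMatrix_eq he hy.1, hX.metricMatrix_eq he' hφy, hgram]
  rw [det_gramAt_comp hYd (hφd hy), Real.sqrt_mul (sq_nonneg _), Real.sqrt_sq_eq_abs,
    ENNReal.ofReal_mul (abs_nonneg _)]

/-- The point is that the supremum adds nothing on `e.source`. Every chart measure splits into its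
parts on `e.source` and on the complement; the first lives on the overlap of the two charts, where
it agrees with `chartVolume e`. So `chartVolume e` plus the volume off `e.source` bounds the whole
family. -/
theorem riemannianVolume_restrict_source (hX : IsIsometricImmersion n X)
    (he : e ∈ atlas (Euc n) M) : (riemannianVolume n M).restrict e.source = chartVolume e := by
  have hS := e.open_source.measurableSet
  have hself : (chartVolume e).restrict e.source = chartVolume e :=
    Measure.restrict_eq_self_of_ae_mem (chartVolume_compl_source e)
  refine le_antisymm ?_ ?_
  · have hle : riemannianVolume n M ≤
        chartVolume e + (riemannianVolume n M).restrict e.sourceᶜ := by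
      refine iSup₂_le fun f hf => ?_
      rw [← Measure.restrict_add_restrict_compl (μ := chartVolume f) hS]
      refine add_le_add ?_ (Measure.restrict_mono subset_rfl (chartVolume_le_riemannianVolume hf))
      refine Measure.le_iff.2 fun A hA => ?_
      rw [Measure.restrict_apply hA]
      have h1 : chartVolume f (A ∩ e.source) ≤ chartVolume f (A ∩ e.source ∩ f.source) := by
        have := measure_inter_add_sdiff (μ := chartVolume f) (A ∩ e.source)
          f.open_source.measurableSet
        rw [← this, measure_mono_null (Set.sdiff_subset_compl _ _) (chartVolume_compl_source f),
          add_zero]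
      refine h1.trans ?_
      rw [chartVolume_eq_chartVolume hX hf he
        ((hA.inter hS).inter f.open_source.measurableSet) Set.inter_subset_right
        (Set.inter_subset_left.trans Set.inter_subset_right)]
      exact measure_mono (Set.inter_subset_left.trans Set.inter_subset_left)
    have := Measure.restrict_mono (subset_refl e.source) hle
    rwa [Measure.restrict_add, hself, Measure.restrict_restrict hS, Set.inter_compl_self,
      Measure.restrict_empty, add_zero] at this
  · rw [← hself]
    exact Measure.restrict_mono subset_rfl (chartVolume_le_riemannianVolume he)

/-- The density is continuous, hence bounded on a small coordinate ball. This makes continuous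
compactly supported functions integrable. -/
theorem isLocallyFiniteMeasure_riemannianVolume (hX : IsIsometricImmersion n X) :
    IsLocallyFiniteMeasure (riemannianVolume n M) := by
  refine ⟨fun p => ?_⟩
  set e := chartAt (Euc n) p
  have he : e ∈ atlas (Euc n) M := chart_mem_atlas _ p
  have hp : p ∈ e.source := mem_chart_source _ p
  have hy := e.map_source hp
  have hc := (continuousOn_sqrt_det_metricMatrix hX he).continuousAt (e.open_target.mem_nhds hy)
  have hev := (hc.eventually_lt continuousAt_const (lt_add_one _)).and (e.open_target.mem_nhds hy)
  obtain ⟨r, hr, hball⟩ := Metric.eventually_nhds_iff_ball.1 hev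
  set C := √(metricMatrix e (e p)).det + 1
  have hopen := e.isOpen_inter_preimage (Metric.isOpen_ball (x := e p) (ε := r))
  refine ⟨e.source ∩ e ⁻¹' Metric.ball (e p) r, hopen.mem_nhds ⟨hp, Metric.mem_ball_self hr⟩, ?_⟩
  have h1 : riemannianVolume n M (e.source ∩ e ⁻¹' Metric.ball (e p) r) =
      chartVolume e (e.source ∩ e ⁻¹' Metric.ball (e p) r) := by
    rw [← riemannianVolume_restrict_source hX he, Measure.restrict_apply hopen.measurableSet,
      Set.inter_eq_left.2 Set.inter_subset_left]
  rw [h1, chartVolume_apply e hopen.measurableSet]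
  have h2 : e.target ∩ e.symm ⁻¹' (e.source ∩ e ⁻¹' Metric.ball (e p) r) ⊆
      Metric.ball (e p) r := by
    rintro y ⟨hy, -, hy'⟩
    rwa [Set.mem_preimage, e.right_inv hy] at hy'
  refine (lintegral_mono_set h2).trans_lt ?_
  refine (setLIntegral_mono (g := fun _ => ENNReal.ofReal C) measurable_const fun y hy =>
    ENNReal.ofReal_le_ofReal (hball y hy).1.le).trans_lt ?_
  rw [setLIntegral_const]
  exact ENNReal.mul_lt_top ENNReal.ofReal_lt_top measure_ball_lt_top

theorem integral_riemannianVolume_of_support_subset (hX : IsIsometricImmersion n X)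
    (he : e ∈ atlas (Euc n) M) {g : M → ℝ} (hg : AEStronglyMeasurable g (riemannianVolume n M))
    (h0 : ∀ p ∉ e.source, g p = 0) : ∫ p, g p ∂riemannianVolume n M =
      ∫ y in e.target, √(metricMatrix e y).det * g (e.symm y) := by
  have hdens : AEMeasurable (fun y => ENNReal.ofReal √(metricMatrix e y).det)
      (volume.restrict e.target) :=
    ((continuousOn_sqrt_det_metricMatrix hX he).aemeasurable
      e.open_target.measurableSet).ennreal_ofReal
  rw [← setIntegral_eq_integral_of_forall_compl_eq_zero h0, riemannianVolume_restrict_source hX he]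
  have hg' := hg.mono_measure (chartVolume_le_riemannianVolume he)
  rw [chartVolume] at hg' ⊢
  rw [integral_map ((aemeasurable_symm e).mono_ac (withDensity_absolutelyContinuous _ _)) hg',
    integral_withDensity_eq_integral_toReal_smul₀ hdens
      (Filter.Eventually.of_forall fun _ => ENNReal.ofReal_lt_top)]
  simp [ENNReal.toReal_ofReal, Real.sqrt_nonneg]

end Volume

/-! ### The divergence theorem for u X^T on M -/

section Divergence

variable {n k : ℕ} {M : Type*} [TopologicalSpace M] [ChartedSpace (Euc n) M]

/-- The derivative of `u` in the direction of the tangential part of the position vector. -/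
def positionDeriv (X : M → Euc k) (u : M → ℝ) (p : M) : ℝ :=
  mfderiv (𝓡 n) 𝓘(ℝ, ℝ) u p (positionField n X p)

theorem positionDeriv_add (X : M → Euc k) {u v : M → ℝ} {p : M}
    (hu : MDifferentiableAt (𝓡 n) 𝓘(ℝ, ℝ) u p) (hv : MDifferentiableAt (𝓡 n) 𝓘(ℝ, ℝ) v p) :
    positionDeriv (n := n) X (u + v) p =
      positionDeriv (n := n) X u p + positionDeriv (n := n) X v p :=
  congrArg (fun T : TangentSpace (𝓡 n) p →L[ℝ] ℝ => T (positionField n X p)) (mfderiv_add hu hv)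

theorem positionDeriv_sum {ι : Type*} (X : M → Euc k) (F : Finset ι) {v : ι → M → ℝ} {p : M}
    (hv : ∀ i, MDifferentiableAt (𝓡 n) 𝓘(ℝ, ℝ) (v i) p) :
    MDifferentiableAt (𝓡 n) 𝓘(ℝ, ℝ) (∑ i ∈ F, v i) p ∧
      positionDeriv (n := n) X (∑ i ∈ F, v i) p = ∑ i ∈ F, positionDeriv (n := n) X (v i) p := by
  classical
  induction F using Finset.induction_on with
  | empty =>
    refine ⟨mdifferentiableAt_const (c := (0 : ℝ)), ?_⟩
    rw [positionDeriv, Finset.sum_empty, Finset.sum_empty]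
    exact congrArg (fun T : TangentSpace (𝓡 n) p →L[ℝ] ℝ => T (positionField n X p))
      (mfderiv_const (c := (0 : ℝ)))
  | insert i s hi ih =>
    rw [Finset.sum_insert hi, Finset.sum_insert hi, positionDeriv_add X (hv i) ih.1, ih.2]
    exact ⟨(hv i).add ih.1, rfl⟩

/-- The divergence of `u X^T`, where `X` is the position vector of a self-shrinker. -/
def shrinkerDiv (X : M → Euc k) (u : M → ℝ) (p : M) : ℝ :=
  positionDeriv (n := n) X u p + u p * (n - ‖normalPart n X p (X p)‖ ^ 2 / 2)

theorem shrinkerDiv_eq_zero_of_notMem_tsupport {X : M → Euc k} {u : M → ℝ} {p : M}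
    (hp : p ∉ tsupport u) :
    shrinkerDiv (n := n) X u p = 0 := by
  have h : u =ᶠ[nhds p] fun _ => (0 : ℝ) := notMem_tsupport_iff_eventuallyEq.1 hp
  have h2 : positionDeriv (n := n) X u p = 0 := by
    rw [positionDeriv, h.mfderiv_eq, mfderiv_const]
    rfl
  rw [shrinkerDiv, h.self_of_nhds, h2]
  simp

theorem hasCompactSupport_shrinkerDiv [T2Space M] {X : M → Euc k} {u : M → ℝ}
    (hc : HasCompactSupport u) :
    HasCompactSupport (shrinkerDiv (n := n) X u) :=
  HasCompactSupport.intro hc fun _ hp => shrinkerDiv_eq_zero_of_notMem_tsupport hp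

variable [IsManifold (𝓡 n) ∞ M] [RiemannianBundle (fun p : M => TangentSpace (𝓡 n) p)]
  {X : M → Euc k} {e : OpenPartialHomeomorph M (Euc n)} {u : M → ℝ}

/-- Links the patch to the manifold: the coordinate trace equals the trace over an orthonormal basis
of the tangent space, which is the known divergence of X^T. -/
theorem trace_stressAt (hX : IsIsometricImmersion n X) (hs : IsSelfShrinker n X)
    (he : e ∈ atlas (Euc n) M) {y : Euc n} (hy : y ∈ e.target) :
    ((gramAt (X ∘ e.symm) y)⁻¹ * stressAt (fun z => fderiv ℝ (X ∘ e.symm) z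
      (tangentCoord (X ∘ e.symm) z)) (X ∘ e.symm) y).trace =
      n - ‖normalPart n X (e.symm y) (X (e.symm y))‖ ^ 2 / 2 := by
  rw [← sum_inner_mfderiv_tangentPart hX hs]
  have h := sum_orthonormalBasis_eq_trace
    (stdOrthonormalBasis ℝ (TangentSpace (𝓡 n) (e.symm y))) (coordBasis he hy)
    ((innerₗ (Euc k)).compl₁₂ (differential n (tangentPart n X) (e.symm y)).toLinearMap
      (differential n X (e.symm y)).toLinearMap)
  refine Eq.trans ?_ h.symm
  have hev : (fun z => fderiv ℝ (X ∘ e.symm) z (tangentCoord (X ∘ e.symm) z)) =ᶠ[nhds y]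
      tangentPart n X ∘ e.symm := by
    filter_upwards [e.open_target.mem_nhds hy] with z hz using fderiv_tangentCoord hX he hz
  congr 3
  · ext i j
    rw [gramAt_apply, Matrix.gram_apply, ← hX.2, coordBasis_apply, coordBasis_apply,
      fderiv_comp_symm he hy (hX.mdifferentiableAt _),
      fderiv_comp_symm he hy (hX.mdifferentiableAt _)]
    rfl
  · ext i j
    simp only [stressAt, Matrix.of_apply, hev.fderiv_eq]
    rw [fderiv_comp_symm he hy (hX.mdifferentiableAt _),
      fderiv_comp_symm he hy (mdifferentiableAt_tangentPart hX _), coordBasis_apply,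
      coordBasis_apply]
    rfl

theorem positionDeriv_eq (hX : IsIsometricImmersion n X)
    (he : e ∈ atlas (Euc n) M) (hu : ContMDiff (𝓡 n) 𝓘(ℝ, ℝ) ∞ u) {y : Euc n} (hy : y ∈ e.target) :
    positionDeriv (n := n) X u (e.symm y) =
      fderiv ℝ (u ∘ e.symm) y (tangentCoord (X ∘ e.symm) y) := by
  rw [positionDeriv, fderiv_comp_symm he hy (hu.mdifferentiable (by simp) _),
    mfderiv_symm_tangentCoord hX he hy]

theorem continuous_normalPart (hX : IsIsometricImmersion n X) :
    Continuous fun p => normalPart n X p (X p) :=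
  continuous_iff_continuousAt.2 fun p => (mdifferentiableAt_normalPart hX p).continuousAt

theorem continuous_positionDeriv (hX : IsIsometricImmersion n X)
    (hu : ContMDiff (𝓡 n) 𝓘(ℝ, ℝ) ∞ u) :
    Continuous (positionDeriv (n := n) X u) := by
  refine continuous_iff_continuousAt.2 fun p => ?_
  set e := chartAt (Euc n) p
  have he : e ∈ atlas (Euc n) M := chart_mem_atlas _ p
  have hp : p ∈ e.source := mem_chart_source _ p
  have hy := e.open_target.mem_nhds (e.map_source hp)
  have h1 : ContinuousAt (fun y => fderiv ℝ (u ∘ e.symm) y (tangentCoord (X ∘ e.symm) y)) (e p) :=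
    (((contDiffOn_comp_symm hu he).contDiffAt hy).fderiv_right (m := ∞)
      (by simp)).continuousAt.clm_apply ((contDiffOn_tangentCoord hX he).contDiffAt hy).continuousAt
  refine (h1.comp (f := e) (e.continuousAt hp)).congr ?_
  filter_upwards [e.open_source.mem_nhds hp] with q hq
  rw [Function.comp_apply, ← positionDeriv_eq hX he hu (e.map_source hq), e.left_inv hq]

theorem continuous_shrinkerDiv (hX : IsIsometricImmersion n X)
    (hu : ContMDiff (𝓡 n) 𝓘(ℝ, ℝ) ∞ u) : Continuous (shrinkerDiv (n := n) X u) :=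
  (continuous_positionDeriv hX hu).add (hu.continuous.mul
    (continuous_const.sub (((continuous_normalPart hX).norm.pow 2).div_const 2)))

variable [MeasurableSpace M] [BorelSpace M] [T2Space M]

theorem integral_shrinkerDiv_of_tsupport_subset (hX : IsIsometricImmersion n X)
    (hs : IsSelfShrinker n X) (he : e ∈ atlas (Euc n) M) (hu : ContMDiff (𝓡 n) 𝓘(ℝ, ℝ) ∞ u)
    (hc : HasCompactSupport u) (hsub : tsupport u ⊆ e.source) :
    ∫ p, shrinkerDiv (n := n) X u p ∂riemannianVolume n M = 0 := by
  have := isLocallyFiniteMeasure_riemannianVolume hX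
  have hm := (continuous_shrinkerDiv hX hu).integrable_of_hasCompactSupport
    (μ := riemannianVolume n M) (hasCompactSupport_shrinkerDiv hc)
  rw [integral_riemannianVolume_of_support_subset hX he hm.aestronglyMeasurable
    fun p hp => shrinkerDiv_eq_zero_of_notMem_tsupport fun h => hp (hsub h)]
  have hK : IsCompact (e '' tsupport u) := hc.isCompact.image_of_continuousOn
    (e.continuousOn.mono hsub)
  have hKU : e '' tsupport u ⊆ e.target := by
    rintro _ ⟨p, hp, rfl⟩
    exact e.map_source (hsub hp)
  -- Outside `e.target` the values of `e.symm` carry no meaning, so the function is set to zero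
  -- there; near points of the target this changes nothing.
  have h := (integral_tangential_divergence (u := e.target.indicator (u ∘ e.symm))
    e.open_target hK hKU (contDiffOn_comp_symm hX.1 he)
    (fun y hy => hX.injective_fderiv he hy) ((contDiffOn_tangentCoord hX he).of_le (by simp))
    (((contDiffOn_comp_symm hu he).congr fun y hy => Set.indicator_of_mem hy _).of_le (by simp))
    fun y hy => ?_).2
  · rw [← h]
    refine setIntegral_congr_fun e.open_target.measurableSet fun y hy => ?_
    have hev : e.target.indicator (u ∘ e.symm) =ᶠ[nhds y] u ∘ e.symm := by
      filter_upwards [e.open_target.mem_nhds hy] with z hz using Set.indicator_of_mem hz _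
    simp only [hev.fderiv_eq, trace_stressAt hX hs he hy, Set.indicator_of_mem hy,
      hX.metricMatrix_eq he hy, shrinkerDiv, Function.comp_apply]
    rw [← positionDeriv_eq hX he hu hy]
  · by_cases hyt : y ∈ e.target
    · rw [Set.indicator_of_mem hyt, Function.comp_apply]
      refine image_eq_zero_of_notMem_tsupport fun h => hy ⟨_, h, e.right_inv hyt⟩
    · exact Set.indicator_of_notMem hyt _

/-- The divergence theorem for `u X^T` with compactly supported `u`. -/
theorem integral_shrinkerDiv [SigmaCompactSpace M] (hX : IsIsometricImmersion n X)
    (hs : IsSelfShrinker n X) (hu : ContMDiff (𝓡 n) 𝓘(ℝ, ℝ) ∞ u) (hc : HasCompactSupport u) :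
    ∫ p, shrinkerDiv (n := n) X u p ∂riemannianVolume n M = 0 := by
  have := isLocallyFiniteMeasure_riemannianVolume hX
  -- Only finitely many ρ_i meet the compact support of u, and `shrinkerDiv` is linear in u, so the
  -- chart case applies to each ρ_i u.
  obtain ⟨ρ, hρ⟩ := SmoothPartitionOfUnity.exists_isSubordinate_chartAt_source (𝓡 n) M
  have hfin : {i | ((Function.support (ρ i)) ∩ tsupport u).Nonempty}.Finite :=
    ρ.locallyFinite.finite_nonempty_inter_compact hc
  set F := hfin.toFinset
  have hsum (p : M) : u p = ∑ i ∈ F, ρ i p * u p := by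
    by_cases hp : p ∈ tsupport u
    · have h1 := ρ.sum_eq_one (Set.mem_univ p)
      rw [finsum_eq_sum_of_support_subset (s := F) _ fun i hi => ?_] at h1
      · rw [← Finset.sum_mul, h1, one_mul]
      · simp only [F, Set.Finite.coe_toFinset, Set.mem_ofPred_eq]
        exact ⟨p, hi, hp⟩
    · simp [image_eq_zero_of_notMem_tsupport hp]
  have hv (i : M) : ContMDiff (𝓡 n) 𝓘(ℝ, ℝ) ∞ fun p => ρ i p * u p := (ρ i).contMDiff.mul hu
  have hvc (i : M) : HasCompactSupport fun p => ρ i p * u p := hc.mul_left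
  have hdiv : shrinkerDiv (n := n) X u =
      fun p => ∑ i ∈ F, shrinkerDiv (n := n) X (fun q => ρ i q * u q) p := by
    funext p
    simp only [shrinkerDiv, Finset.sum_add_distrib, ← Finset.sum_mul, ← hsum]
    congr 1
    rw [← (positionDeriv_sum X F fun i => (hv i).mdifferentiable (by simp) p).2]
    exact congrArg (fun w => positionDeriv (n := n) X w p) (by ext q; simp [← hsum])
  rw [hdiv, integral_finsetSum _ fun i _ => (continuous_shrinkerDiv hX
    (hv i)).integrable_of_hasCompactSupport (hasCompactSupport_shrinkerDiv (hvc i))]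
  refine Finset.sum_eq_zero fun i _ => integral_shrinkerDiv_of_tsupport_subset hX hs
    (chart_mem_atlas _ i) (hv i) (hvc i) ?_
  exact (closure_mono (Function.support_mul_subset_left _ _)).trans (hρ i)

end Divergence

/-! ### Cutoff functions -/

/-- A smooth cutoff function on the line, equal to `1` on `(-∞, R]` and to `0` on `[2R, ∞)`. -/
def cutoff (R s : ℝ) : ℝ := 1 - Real.smoothTransition (s / R - 1)

namespace cutoff

theorem contDiff (R : ℝ) : ContDiff ℝ ∞ (cutoff R) :=
  contDiff_const.sub (Real.smoothTransition.contDiff.comp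
    ((contDiff_id.div_const R).sub contDiff_const))

theorem nonneg (R s : ℝ) : 0 ≤ cutoff R s := sub_nonneg.2 (Real.smoothTransition.le_one _)

theorem le_one (R s : ℝ) : cutoff R s ≤ 1 := sub_le_self _ (Real.smoothTransition.nonneg _)

theorem eq_one {R s : ℝ} (hR : 0 < R) (h : s ≤ R) : cutoff R s = 1 := by
  rw [cutoff, Real.smoothTransition.zero_of_nonpos, sub_zero]
  rw [sub_nonpos, div_le_one hR]
  exact h

theorem eq_zero {R s : ℝ} (hR : 0 < R) (h : 2 * R ≤ s) : cutoff R s = 0 := by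
  rw [cutoff, Real.smoothTransition.one_of_one_le, sub_self]
  rw [le_sub_iff_add_le, le_div_iff₀ hR]
  linarith

/-- By scaling, the derivative is -S'(s/R - 1)/R for the fixed monotone transition S, and S' is
bounded because it is continuous and vanishes off [0, 1]. One constant therefore serves all R. -/
theorem exists_deriv_bound :
    ∃ C : ℝ, 0 ≤ C ∧ ∀ R s : ℝ, 0 < R → deriv (cutoff R) s ≤ 0 ∧ -(C / R) ≤ deriv (cutoff R) s := by
  have hst : ContDiff ℝ 1 Real.smoothTransition := Real.smoothTransition.contDiff (n := 1)
  have hcont : Continuous (deriv Real.smoothTransition) := hst.continuous_deriv le_rfl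
  have hsupp : HasCompactSupport (deriv Real.smoothTransition) := by
    refine HasCompactSupport.intro (isCompact_Icc (a := (0 : ℝ)) (b := 1)) fun x hx => ?_
    rw [Set.mem_Icc, not_and_or, not_le, not_le] at hx
    rcases hx with hx | hx
    · have : Real.smoothTransition =ᶠ[nhds x] fun _ => (0 : ℝ) := by
        filter_upwards [Iio_mem_nhds hx] with z hz
          using Real.smoothTransition.zero_of_nonpos (le_of_lt hz)
      rw [this.deriv_eq, deriv_const]
    · have : Real.smoothTransition =ᶠ[nhds x] fun _ => (1 : ℝ) := by
        filter_upwards [Ioi_mem_nhds hx] with z hz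
          using Real.smoothTransition.one_of_one_le (le_of_lt hz)
      rw [this.deriv_eq, deriv_const]
  obtain ⟨C, hC⟩ := hcont.bounded_above_of_compact_support hsupp
  refine ⟨C, (norm_nonneg _).trans (hC 0), fun R s hR => ?_⟩
  have hd : HasDerivAt (cutoff R) (-(deriv Real.smoothTransition (s / R - 1) * (1 / R))) s := by
    have h1 : HasDerivAt (fun x : ℝ => x / R - 1) (1 / R) s :=
      ((hasDerivAt_id s).div_const R).sub_const 1
    exact (((hst.differentiable (by simp) _).hasDerivAt).comp s h1).const_sub 1
  rw [hd.deriv]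
  have h0 : 0 ≤ deriv Real.smoothTransition (s / R - 1) :=
    Real.smoothTransition.monotone.deriv_nonneg
  have h1 := (le_abs_self _).trans (hC (s / R - 1))
  constructor
  · exact neg_nonpos.2 (by positivity)
  · rw [neg_le_neg_iff, mul_one_div]
    gcongr

end cutoff

/-! ### Comparison of weighted areas on a measure space -/

section Comparison

variable {M : Type*} [TopologicalSpace M] [MeasurableSpace M] [OpensMeasurableSpace M]
  {μ : Measure M} {f a b : M → ℝ} {d : ℝ}

/-- The weighted integral `β^d ∫ φ(f) e^{-βf}` with the cutoff function `φ` at scale `R`. -/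
def cutoffArea (μ : Measure M) (f : M → ℝ) (d R β : ℝ) : ℝ :=
  β ^ d * ∫ p, cutoff R (f p) * Real.exp (-β * f p) ∂μ

theorem tendsto_cutoffArea (hf : Continuous f) {β : ℝ}
    (hint : Integrable (fun p => Real.exp (-β * f p)) μ) :
    Filter.Tendsto (fun j : ℕ => cutoffArea μ f d ((j : ℝ) + 1) β) Filter.atTop
      (nhds (β ^ d * ∫ p, Real.exp (-β * f p) ∂μ)) := by
  refine Filter.Tendsto.const_mul _ (tendsto_integral_of_dominated_convergence _
    (fun j => ?_) hint (fun j => Filter.Eventually.of_forall fun p => ?_)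
    (Filter.Eventually.of_forall fun p => ?_))
  · have : Continuous fun p => cutoff ((j : ℝ) + 1) (f p) * Real.exp (-β * f p) :=
      ((cutoff.contDiff _).continuous.comp hf).mul (by fun_prop)
    exact this.measurable.aestronglyMeasurable
  · rw [norm_mul, Real.norm_of_nonneg (cutoff.nonneg _ _),
      Real.norm_of_nonneg (Real.exp_nonneg _)]
    exact mul_le_of_le_one_left (Real.exp_nonneg _) (cutoff.le_one _ _)
  · obtain ⟨N, hN⟩ := exists_nat_ge (f p)
    refine tendsto_const_nhds.congr' ?_
    filter_upwards [Filter.eventually_ge_atTop N] with j hj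
    have : (N : ℝ) ≤ j := by exact_mod_cast hj
    rw [cutoff.eq_one (by positivity) (by linarith), one_mul]

variable [IsFiniteMeasureOnCompacts μ]

theorem integrable_of_eq_zero_of_le (hK : ∀ R, IsCompact {p | f p ≤ R}) (hf : Continuous f)
    {g : M → ℝ} (hg : Continuous g) {R : ℝ} (h0 : ∀ p, R ≤ f p → g p = 0) : Integrable g μ := by
  refine (integrableOn_iff_integrable_of_support_subset (s := {p | f p ≤ R}) fun p hp => ?_).1
    (hg.continuousOn.integrableOn_compact' (hK R)
      (isClosed_le hf continuous_const).measurableSet)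
  by_contra h
  exact hp (h0 p (not_le.1 h).le)

theorem integrable_cutoff_mul (hK : ∀ R, IsCompact {p | f p ≤ R}) (hf : Continuous f) {g : M → ℝ}
    (hg : Continuous g) {R : ℝ} (hR : 0 < R) :
    Integrable (fun p => cutoff R (f p) * g p) μ :=
  integrable_of_eq_zero_of_le hK hf (R := 2 * R) (((cutoff.contDiff R).continuous.comp hf).mul hg)
    fun p hp => by simp [cutoff.eq_zero hR hp]

theorem integrable_deriv_cutoff_mul (hK : ∀ R, IsCompact {p | f p ≤ R}) (hf : Continuous f)
    {g : M → ℝ} (hg : Continuous g) {R : ℝ} (hR : 0 < R) :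
    Integrable (fun p => deriv (cutoff R) (f p) * g p) μ := by
  -- With 3R in place of 2R, the point f p lies in the open set where the cutoff vanishes
  -- identically, so the derivative is zero there too.
  refine integrable_of_eq_zero_of_le hK hf (R := 3 * R)
    ((((cutoff.contDiff R).continuous_deriv (by simp)).comp hf).mul hg) fun p hp => ?_
  have : cutoff R =ᶠ[nhds (f p)] fun _ => (0 : ℝ) := by
    filter_upwards [Ioi_mem_nhds (show 2 * R < f p by linarith)] with s hs
      using cutoff.eq_zero hR (le_of_lt hs)
  rw [this.deriv_eq, deriv_const, zero_mul]

/-- Differentiating under the integral brings down -f = -(a + b). The weak equation `hdiv` for η(s)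
= φ(s) e^{-βs} trades d∫φe^{-βf} - β∫φ a e^{-βf} for ∫φ b e^{-βf} - ∫φ' a e^{-βf}. -/
theorem hasDerivAt_cutoffArea (hK : ∀ R, IsCompact {p | f p ≤ R}) (hf : Continuous f)
    (ha : Continuous a) (hb : Continuous b) (ha0 : ∀ p, 0 ≤ a p) (hb0 : ∀ p, 0 ≤ b p)
    (hab : ∀ p, a p + b p = f p)
    (hdiv : ∀ (η : ℝ → ℝ) (R : ℝ), ContDiff ℝ ∞ η → (∀ s, R ≤ s → η s = 0) →
      ∫ p, (deriv η (f p) * a p + η (f p) * (d - b p)) ∂μ = 0)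
    {R β : ℝ} (hR : 0 < R) (hβ : 0 < β) :
    HasDerivAt (cutoffArea μ f d R) (β ^ (d - 1) *
      (∫ p, -deriv (cutoff R) (f p) * (a p * Real.exp (-β * f p)) ∂μ +
        (1 - β) * ∫ p, cutoff R (f p) * (b p * Real.exp (-β * f p)) ∂μ)) β := by
  have hf0 (p) : 0 ≤ f p := hab p ▸ add_nonneg (ha0 p) (hb0 p)
  have hexp (β : ℝ) : Continuous fun p => Real.exp (-β * f p) := by fun_prop
  have hJ : HasDerivAt (fun β : ℝ => ∫ p, cutoff R (f p) * Real.exp (-β * f p) ∂μ)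
      (∫ p, cutoff R (f p) * (-f p * Real.exp (-β * f p)) ∂μ) β := by
    -- The bound φ(f) f works for all positive β at once because f ≥ 0 gives e^{-βf} ≤ 1.
    refine (hasDerivAt_integral_of_dominated_loc_of_deriv_le (s := Set.Ioi 0)
      (bound := fun p => cutoff R (f p) * f p)
      (F' := fun β p => cutoff R (f p) * (-f p * Real.exp (-β * f p))) (Ioi_mem_nhds hβ)
      (Filter.Eventually.of_forall fun β =>
        (integrable_cutoff_mul hK hf (hexp β) hR).aestronglyMeasurable)
      (integrable_cutoff_mul hK hf (hexp β) hR)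
      (integrable_cutoff_mul hK hf (hf.neg.mul (hexp β)) hR).aestronglyMeasurable
      (Filter.Eventually.of_forall fun p x hx => ?_) (integrable_cutoff_mul hK hf hf hR)
      (Filter.Eventually.of_forall fun p x hx => ?_)).2
    · rw [norm_mul, norm_mul, norm_neg, Real.norm_of_nonneg (cutoff.nonneg _ _),
        Real.norm_of_nonneg (hf0 p), Real.norm_of_nonneg (Real.exp_nonneg _)]
      refine mul_le_mul_of_nonneg_left (mul_le_of_le_one_right (hf0 p) ?_) (cutoff.nonneg _ _)
      rw [Real.exp_le_one_iff]
      nlinarith [hf0 p, Set.mem_Ioi.1 hx]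
    · have h1 : HasDerivAt (fun x : ℝ => -x * f p) (-f p) x := by
        simpa using (hasDerivAt_id x).neg.mul_const (f p)
      exact (h1.exp.const_mul (cutoff R (f p))).congr_deriv (by ring)
  have hI := (Real.hasDerivAt_rpow_const (p := d) (Or.inl hβ.ne')).mul hJ
  refine hI.congr_deriv ?_
  have hη := hdiv (fun s => cutoff R s * Real.exp (-β * s)) (2 * R)
    ((cutoff.contDiff R).mul (by fun_prop)) fun s hs => by simp [cutoff.eq_zero hR hs]
  have hder (s : ℝ) : deriv (fun s => cutoff R s * Real.exp (-β * s)) s =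
      deriv (cutoff R) s * Real.exp (-β * s) - β * (cutoff R s * Real.exp (-β * s)) := by
    have h1 : HasDerivAt (fun x : ℝ => -β * x) (-β) s := by
      simpa using (hasDerivAt_id s).const_mul (-β)
    rw [((((cutoff.contDiff R).differentiable (by simp) s).hasDerivAt).fun_mul h1.exp).deriv]
    ring
  have hae : Continuous fun p => a p * Real.exp (-β * f p) := ha.mul (hexp β)
  have hbe : Continuous fun p => b p * Real.exp (-β * f p) := hb.mul (hexp β)
  have e1 := integrable_deriv_cutoff_mul (μ := μ) hK hf hae hR
  have e2 := integrable_cutoff_mul (μ := μ) hK hf hae hR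
  have e3 := integrable_cutoff_mul (μ := μ) hK hf hbe hR
  have e4 := integrable_cutoff_mul (μ := μ) hK hf (hexp β) hR
  have hsplit : ∫ p, (deriv (fun s => cutoff R s * Real.exp (-β * s)) (f p) * a p +
      cutoff R (f p) * Real.exp (-β * f p) * (d - b p)) ∂μ =
      (∫ p, deriv (cutoff R) (f p) * (a p * Real.exp (-β * f p)) ∂μ -
        β * ∫ p, cutoff R (f p) * (a p * Real.exp (-β * f p)) ∂μ) +
      (d * (∫ p, cutoff R (f p) * Real.exp (-β * f p) ∂μ) -
        ∫ p, cutoff R (f p) * (b p * Real.exp (-β * f p)) ∂μ) := by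
    have e5 : Integrable (fun p => deriv (cutoff R) (f p) * (a p * Real.exp (-β * f p)) -
        β * (cutoff R (f p) * (a p * Real.exp (-β * f p)))) μ := e1.sub (e2.const_mul β)
    have e6 : Integrable (fun p => d * (cutoff R (f p) * Real.exp (-β * f p)) -
        cutoff R (f p) * (b p * Real.exp (-β * f p))) μ := (e4.const_mul d).sub e3
    rw [← integral_const_mul, ← integral_const_mul, ← integral_sub e1 (e2.const_mul β),
      ← integral_sub (e4.const_mul d) e3,
      ← integral_add e5 e6]
    refine integral_congr_ae (Filter.Eventually.of_forall fun p => ?_)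
    simp only [hder]
    ring
  rw [hsplit] at hη
  have hff : ∫ p, cutoff R (f p) * (-f p * Real.exp (-β * f p)) ∂μ =
      -(∫ p, cutoff R (f p) * (a p * Real.exp (-β * f p)) ∂μ +
        ∫ p, cutoff R (f p) * (b p * Real.exp (-β * f p)) ∂μ) := by
    rw [← integral_add e2 e3, ← integral_neg]
    refine integral_congr_ae (Filter.Eventually.of_forall fun p => ?_)
    simp only [← hab p]
    ring
  have hneg : ∫ p, -deriv (cutoff R) (f p) * (a p * Real.exp (-β * f p)) ∂μ =
      -∫ p, deriv (cutoff R) (f p) * (a p * Real.exp (-β * f p)) ∂μ := by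
    rw [← integral_neg]
    simp only [neg_mul]
  have hpow : β ^ d = β ^ (d - 1) * β := by
    rw [Real.rpow_sub_one hβ.ne', div_mul_cancel₀ _ hβ.ne']
  rw [hff, hneg, hpow]
  linear_combination (β ^ (d - 1)) * hη

/-- On [β, 1] both terms of the derivative are nonnegative: φ' ≤ 0 and 1 - x ≥ 0. No integrability
at infinity is needed. -/
theorem cutoffArea_le_of_le_one (hK : ∀ R, IsCompact {p | f p ≤ R}) (hf : Continuous f)
    (ha : Continuous a) (hb : Continuous b) (ha0 : ∀ p, 0 ≤ a p) (hb0 : ∀ p, 0 ≤ b p)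
    (hab : ∀ p, a p + b p = f p)
    (hdiv : ∀ (η : ℝ → ℝ) (R : ℝ), ContDiff ℝ ∞ η → (∀ s, R ≤ s → η s = 0) →
      ∫ p, (deriv η (f p) * a p + η (f p) * (d - b p)) ∂μ = 0)
    {R β : ℝ} (hR : 0 < R) (hβ : 0 < β) (hβ1 : β ≤ 1) :
    cutoffArea μ f d R β ≤ cutoffArea μ f d R 1 := by
  obtain ⟨C, -, hC⟩ := cutoff.exists_deriv_bound
  have hd {x : ℝ} (hx : 0 < x) := hasDerivAt_cutoffArea hK hf ha hb ha0 hb0 hab hdiv hR hx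
  refine monotoneOn_of_deriv_nonneg (convex_Icc β 1)
    (fun x hx => (hd (hβ.trans_le hx.1)).continuousAt.continuousWithinAt)
    (fun x hx => (hd (hβ.trans_le (interior_subset hx).1)).differentiableAt.differentiableWithinAt)
    (fun x hx => ?_) ⟨le_rfl, hβ1⟩ ⟨hβ1, le_rfl⟩ hβ1
  have hx' := interior_subset hx
  have hx0 : 0 < x := hβ.trans_le hx'.1
  rw [(hd hx0).deriv]
  refine mul_nonneg (Real.rpow_nonneg hx0.le _) (add_nonneg (integral_nonneg fun p => ?_)
    (mul_nonneg (sub_nonneg.2 hx'.2) (integral_nonneg fun p => ?_)))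
  · exact mul_nonneg (neg_nonneg.2 (hC R _ hR).1) (mul_nonneg (ha0 p) (Real.exp_nonneg _))
  · exact mul_nonneg (cutoff.nonneg _ _) (mul_nonneg (hb0 p) (Real.exp_nonneg _))

/-- An absorption argument. Where f ≥ K, e^{-f} ≤ (β^d/2) e^{-βf} since β < 1, so the hypothesis
gives β^d J ≤ (β^d/2) J + V for the cutoff integral J at β, with V the integral of e^{-f} over the
compact set {f ≤ K}. As J is finite, J ≤ 2V/β^d, uniformly in R. -/
theorem integrable_exp_of_cutoffArea_le (hK : ∀ R, IsCompact {p | f p ≤ R}) (hf : Continuous f)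
    {β : ℝ} (hβ : 0 < β) (hβ1 : β < 1)
    (hle : ∀ R, 0 < R → cutoffArea μ f d R β ≤ cutoffArea μ f d R 1) :
    Integrable (fun p => Real.exp (-β * f p)) μ := by
  have hexp (β : ℝ) : Continuous fun p => Real.exp (-β * f p) := by fun_prop
  have hpow : 0 < β ^ d := Real.rpow_pos_of_pos hβ d
  obtain ⟨K, hKs⟩ : ∃ K : ℝ, ∀ s, K ≤ s →
      Real.exp (-1 * s) ≤ β ^ d / 2 * Real.exp (-β * s) := by
    have h1 : Filter.Tendsto (fun s : ℝ => Real.exp (-((1 - β) * s))) Filter.atTop (nhds 0) :=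
      Real.tendsto_exp_neg_atTop_nhds_zero.comp
        (Filter.tendsto_id.const_mul_atTop (sub_pos.2 hβ1))
    obtain ⟨K, hK⟩ := Filter.eventually_atTop.1 (h1.eventually_le_const (half_pos hpow))
    refine ⟨K, fun s hs => ?_⟩
    have h2 : Real.exp (-1 * s) = Real.exp (-((1 - β) * s)) * Real.exp (-β * s) := by
      rw [← Real.exp_add]
      ring_nf
    rw [h2]
    exact mul_le_mul_of_nonneg_right (hK s hs) (Real.exp_nonneg _)
  have hmeas (R : ℝ) : MeasurableSet {p | f p ≤ R} :=
    (isClosed_le hf continuous_const).measurableSet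
  set V : ℝ := ∫ p in {p | f p ≤ K}, Real.exp (-1 * f p) ∂μ with hV
  have hbound (R : ℝ) (hR : 0 < R) :
      ∫ p, cutoff R (f p) * Real.exp (-β * f p) ∂μ ≤ 2 * V / β ^ d := by
    have i1 := integrable_cutoff_mul (μ := μ) hK hf (hexp 1) hR
    have iβ := integrable_cutoff_mul (μ := μ) hK hf (hexp β) hR
    have iV : Integrable ({p | f p ≤ K}.indicator fun p => Real.exp (-1 * f p)) μ :=
      ((hexp 1).continuousOn.integrableOn_compact' (hK K) (hmeas K)).integrable_indicator (hmeas K)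
    have h1 : ∫ p, cutoff R (f p) * Real.exp (-1 * f p) ∂μ ≤
        β ^ d / 2 * (∫ p, cutoff R (f p) * Real.exp (-β * f p) ∂μ) + V := by
      rw [hV, ← integral_indicator (hmeas K), ← integral_const_mul,
        ← integral_add (iβ.const_mul _) iV]
      refine integral_mono i1 ((iβ.const_mul _).add iV) fun p => ?_
      simp only
      by_cases hp : f p ≤ K
      · rw [Set.indicator_of_mem (show p ∈ {p | f p ≤ K} from hp)]
        refine le_add_of_nonneg_of_le (mul_nonneg (half_pos hpow).le
          (mul_nonneg (cutoff.nonneg _ _) (Real.exp_nonneg _))) ?_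
        exact mul_le_of_le_one_left (Real.exp_nonneg _) (cutoff.le_one _ _)
      · rw [Set.indicator_of_notMem (show p ∉ {p | f p ≤ K} from hp), add_zero, mul_left_comm]
        exact mul_le_mul_of_nonneg_left (hKs _ (not_le.1 hp).le) (cutoff.nonneg _ _)
    have h2 := hle R hR
    rw [cutoffArea, cutoffArea, Real.one_rpow, one_mul] at h2
    rw [le_div_iff₀ hpow]
    linarith
  have hcover : AECover μ Filter.atTop fun j : ℕ => {p | f p ≤ (j : ℝ) + 1} :=
    ⟨Filter.Eventually.of_forall fun p => by
      obtain ⟨N, hN⟩ := exists_nat_ge (f p)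
      filter_upwards [Filter.eventually_ge_atTop N] with j hj
      have : (N : ℝ) ≤ j := by exact_mod_cast hj
      exact (by linarith : f p ≤ (j : ℝ) + 1), fun j => hmeas _⟩
  refine hcover.integrable_of_integral_bounded_of_nonneg_ae (2 * V / β ^ d)
    (fun j => (hexp β).continuousOn.integrableOn_compact' (hK _) (hmeas _))
    (Filter.Eventually.of_forall fun p => Real.exp_nonneg _)
    (Filter.Eventually.of_forall fun j => ?_)
  have hj : (0 : ℝ) < (j : ℝ) + 1 := by positivity
  refine le_trans ?_ (hbound _ hj)
  rw [← integral_indicator (hmeas _)]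
  refine integral_mono (((hexp β).continuousOn.integrableOn_compact' (hK _)
    (hmeas _)).integrable_indicator (hmeas _)) (integrable_cutoff_mul hK hf (hexp β) hj) fun p => ?_
  by_cases hp : f p ≤ (j : ℝ) + 1
  · rw [Set.indicator_of_mem (show p ∈ {p | f p ≤ (j : ℝ) + 1} from hp), cutoff.eq_one hj hp,
      one_mul]
  · rw [Set.indicator_of_notMem (show p ∉ {p | f p ≤ (j : ℝ) + 1} from hp)]
    exact mul_nonneg (cutoff.nonneg _ _) (Real.exp_nonneg _)

/-- For x ≥ 1 the b-term has the right sign, but the cutoff term now works against the claim. It is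
at most (C/R) ∫ f e^{-f}, using a ≤ f and x ≥ 1. -/
theorem cutoffArea_le_add_of_one_le (hK : ∀ R, IsCompact {p | f p ≤ R}) (hf : Continuous f)
    (ha : Continuous a) (hb : Continuous b) (ha0 : ∀ p, 0 ≤ a p) (hb0 : ∀ p, 0 ≤ b p)
    (hab : ∀ p, a p + b p = f p) (hd0 : 0 ≤ d)
    (hdiv : ∀ (η : ℝ → ℝ) (R : ℝ), ContDiff ℝ ∞ η → (∀ s, R ≤ s → η s = 0) →
      ∫ p, (deriv η (f p) * a p + η (f p) * (d - b p)) ∂μ = 0)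
    (hint : Integrable (fun p => f p * Real.exp (-1 * f p)) μ) {β : ℝ} (hβ : 1 ≤ β) :
    ∃ D : ℝ, ∀ R, 0 < R → cutoffArea μ f d R β ≤ cutoffArea μ f d R 1 + D / R := by
  obtain ⟨C, hC0, hC⟩ := cutoff.exists_deriv_bound
  set Z := ∫ p, f p * Real.exp (-1 * f p) ∂μ with hZ
  have hf0 (p) : 0 ≤ f p := hab p ▸ add_nonneg (ha0 p) (hb0 p)
  have hZ0 : 0 ≤ Z := integral_nonneg fun p => mul_nonneg (hf0 p) (Real.exp_nonneg _)
  refine ⟨β ^ d * (C * Z) * (β - 1), fun R hR => ?_⟩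
  have hd {x : ℝ} (hx : 0 < x) := hasDerivAt_cutoffArea hK hf ha hb ha0 hb0 hab hdiv hR hx
  have hpos {x : ℝ} (hx : x ∈ Set.Icc 1 β) : 0 < x := zero_lt_one.trans_le hx.1
  have h := (convex_Icc 1 β).image_sub_le_mul_sub_of_deriv_le
    (f := cutoffArea μ f d R) (C := β ^ d * (C * Z / R))
    (fun x hx => (hd (hpos hx)).continuousAt.continuousWithinAt)
    (fun x hx => (hd (hpos (interior_subset hx))).differentiableAt.differentiableWithinAt)
    (fun x hx => ?_) 1 ⟨le_rfl, hβ⟩ β ⟨hβ, le_rfl⟩ hβ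
  · have h2 : β ^ d * (C * Z) * (β - 1) / R = β ^ d * (C * Z / R) * (β - 1) := by ring
    rw [h2]
    linarith
  have hx' := interior_subset hx
  have hx0 := hpos hx'
  rw [(hd hx0).deriv]
  have hae : Continuous fun p => a p * Real.exp (-x * f p) := by fun_prop
  have h1 : ∫ p, -deriv (cutoff R) (f p) * (a p * Real.exp (-x * f p)) ∂μ ≤ C * Z / R := by
    have h2 : C * Z / R = ∫ p, C / R * (f p * Real.exp (-1 * f p)) ∂μ := by
      rw [integral_const_mul, hZ]
      ring
    rw [h2]
    refine integral_mono ?_ (hint.const_mul _) fun p => ?_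
    · exact (integrable_deriv_cutoff_mul hK hf hae hR).neg.congr
        (Filter.Eventually.of_forall fun p => by simp)
    · have h3 := hC R (f p) hR
      refine mul_le_mul (by linarith) (mul_le_mul ?_ (Real.exp_le_exp.2 ?_)
        (Real.exp_nonneg _) (hf0 p)) (mul_nonneg (ha0 p) (Real.exp_nonneg _)) (by positivity)
      · linarith [hab p, hb0 p]
      · nlinarith [hf0 p, hx'.1]
  have h2 : (1 - x) * ∫ p, cutoff R (f p) * (b p * Real.exp (-x * f p)) ∂μ ≤ 0 :=
    mul_nonpos_of_nonpos_of_nonneg (sub_nonpos.2 hx'.1) (integral_nonneg fun p =>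
      mul_nonneg (cutoff.nonneg _ _) (mul_nonneg (hb0 p) (Real.exp_nonneg _)))
  have h3 : x ^ (d - 1) ≤ β ^ d :=
    (Real.rpow_le_rpow_of_exponent_le hx'.1 (by linarith)).trans
      (Real.rpow_le_rpow hx0.le hx'.2 hd0)
  refine (mul_le_mul_of_nonneg_left (by linarith : _ ≤ C * Z / R)
    (Real.rpow_nonneg hx0.le _)).trans (mul_le_mul_of_nonneg_right h3 (by positivity))

/-- Comparison of weighted areas from the weak form of `Δf = n/2 - b`, `|∇f|² = a = f - b`. -/
theorem integrable_exp_and_rpow_mul_integral_le (hK : ∀ R, IsCompact {p | f p ≤ R})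
    (hf : Continuous f) (ha : Continuous a) (hb : Continuous b) (ha0 : ∀ p, 0 ≤ a p)
    (hb0 : ∀ p, 0 ≤ b p) (hab : ∀ p, a p + b p = f p) (hd0 : 0 ≤ d)
    (hdiv : ∀ (η : ℝ → ℝ) (R : ℝ), ContDiff ℝ ∞ η → (∀ s, R ≤ s → η s = 0) →
      ∫ p, (deriv η (f p) * a p + η (f p) * (d - b p)) ∂μ = 0) {β : ℝ} (hβ : 0 < β) :
    Integrable (fun p => Real.exp (-β * f p)) μ ∧
      β ^ d * ∫ p, Real.exp (-β * f p) ∂μ ≤ ∫ p, Real.exp (-1 * f p) ∂μ := by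
  have hf0 (p) : 0 ≤ f p := hab p ▸ add_nonneg (ha0 p) (hb0 p)
  have hle {γ R : ℝ} (hγ : 0 < γ) (hγ1 : γ ≤ 1) (hR : 0 < R) :=
    cutoffArea_le_of_le_one hK hf ha hb ha0 hb0 hab hdiv hR hγ hγ1
  have hsmall {γ : ℝ} (hγ : 0 < γ) (hγ1 : γ < 1) : Integrable (fun p => Real.exp (-γ * f p)) μ :=
    integrable_exp_of_cutoffArea_le hK hf hγ hγ1 fun R hR => hle hγ hγ1.le hR
  -- e^{-γf} decreases in γ, so the case γ < 1 gives every γ > 0; any number below 1 could replace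
  -- 1/2.
  have hint {γ : ℝ} (hγ : 0 < γ) : Integrable (fun p => Real.exp (-γ * f p)) μ := by
    have hmin : 0 < min γ (1 / 2) := lt_min hγ (by norm_num)
    refine (hsmall hmin ((min_le_right _ _).trans_lt (by norm_num))).mono'
      (by fun_prop : Continuous fun p => Real.exp (-γ * f p)).measurable.aestronglyMeasurable
      (Filter.Eventually.of_forall fun p => ?_)
    rw [Real.norm_of_nonneg (Real.exp_nonneg _)]
    exact Real.exp_le_exp.2 (mul_le_mul_of_nonneg_right (neg_le_neg (min_le_left _ _)) (hf0 p))
  have hlim1 := tendsto_cutoffArea (d := d) hf (hint one_pos)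
  rw [Real.one_rpow, one_mul] at hlim1
  have hlim := tendsto_cutoffArea (d := d) hf (hint hβ)
  refine ⟨hint hβ, ?_⟩
  rcases le_total β 1 with hβ1 | hβ1
  · exact le_of_tendsto_of_tendsto' hlim hlim1 fun j => hle hβ hβ1 (by positivity)
  · have hfe : Integrable (fun p => f p * Real.exp (-1 * f p)) μ := by
      -- f e^{-f} ≤ 2 e^{-f/2}, from f/2 + 1 ≤ e^{f/2}.
      refine ((hint (γ := 1 / 2) (by norm_num)).const_mul 2).mono'
        (Continuous.measurable (by fun_prop)).aestronglyMeasurable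
        (Filter.Eventually.of_forall fun p => ?_)
      rw [Real.norm_of_nonneg (mul_nonneg (hf0 p) (Real.exp_nonneg _))]
      have h1 : Real.exp (-(1 / 2) * f p) = Real.exp (f p / 2) * Real.exp (-1 * f p) := by
        rw [← Real.exp_add]
        ring_nf
      rw [h1, ← mul_assoc]
      refine mul_le_mul_of_nonneg_right ?_ (Real.exp_nonneg _)
      linarith [Real.add_one_le_exp (f p / 2)]
    obtain ⟨D, hD⟩ := cutoffArea_le_add_of_one_le hK hf ha hb ha0 hb0 hab hd0 hdiv hfe hβ1
    have hlim2 : Filter.Tendsto (fun j : ℕ => D / ((j : ℝ) + 1)) Filter.atTop (nhds 0) :=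
      by simpa [div_eq_mul_inv] using tendsto_one_div_add_atTop_nhds_zero_nat.const_mul D
    have := le_of_tendsto_of_tendsto' hlim (hlim1.add hlim2) fun j => hD _ (by positivity)
    rwa [add_zero] at this

end Comparison

/-! ### The case f = |X|²/4 on a self-shrinker -/

section SelfShrinker

variable {n k : ℕ} {M : Type*} [TopologicalSpace M] [ChartedSpace (Euc n) M]

theorem inner_tangentPart (X : M → Euc k) (p : M) :
    inner ℝ (X p) (tangentPart n X p) = ‖tangentPart n X p‖ ^ 2 := by
  have h := inner_normalPart_differential X p (X p) (positionField n X p)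
  rw [differential_positionField] at h
  conv_lhs => rw [← tangentPart_add_normalPart (n := n) X p]
  rw [inner_add_left, h, add_zero, real_inner_self_eq_norm_sq]

theorem norm_tangentPart_sq_add (X : M → Euc k) (p : M) :
    ‖tangentPart n X p‖ ^ 2 + ‖normalPart n X p (X p)‖ ^ 2 = ‖X p‖ ^ 2 := by
  have h := inner_normalPart_differential X p (X p) (positionField n X p)
  rw [differential_positionField, real_inner_comm] at h
  have h2 := norm_add_sq_eq_norm_sq_add_norm_sq_real h
  rw [tangentPart_add_normalPart] at h2
  linarith

variable [RiemannianBundle (fun p : M => TangentSpace (𝓡 n) p)] {X : M → Euc k}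

theorem positionDeriv_comp_norm_sq (hX : IsIsometricImmersion n X) {η : ℝ → ℝ}
    (hη : ContDiff ℝ ∞ η) (p : M) :
    positionDeriv (n := n) X (fun q => η (‖X q‖ ^ 2 / 4)) p =
      2 * (deriv η (‖X p‖ ^ 2 / 4) * (‖tangentPart n X p‖ ^ 2 / 4)) := by
  have hXp := hX.mdifferentiableAt p
  have h1 : HasFDerivAt (fun x : Euc k => ‖x‖ ^ 2 / 4)
      ((4 : ℝ)⁻¹ • (2 • innerSL ℝ (X p))) (X p) := by
    simp only [div_eq_inv_mul]
    exact (hasStrictFDerivAt_norm_sq (X p)).hasFDerivAt.const_mul (4 : ℝ)⁻¹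
  have h2 : HasFDerivAt (fun x : Euc k => η (‖x‖ ^ 2 / 4))
      (deriv η (‖X p‖ ^ 2 / 4) • ((4 : ℝ)⁻¹ • (2 • innerSL ℝ (X p)))) (X p) :=
    ((hη.differentiable (by simp) _).hasDerivAt).comp_hasFDerivAt (X p) h1
  have h3 := (h2.hasMFDerivAt.comp p hXp.hasMFDerivAt).mfderiv
  have h4 : positionDeriv (n := n) X (fun q => η (‖X q‖ ^ 2 / 4)) p =
      (deriv η (‖X p‖ ^ 2 / 4) • ((4 : ℝ)⁻¹ • (2 • innerSL ℝ (X p))))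
        (differential n X p (positionField n X p)) :=
    congrArg (fun T : TangentSpace (𝓡 n) p →L[ℝ] ℝ => T (positionField n X p)) h3
  rw [h4, differential_positionField]
  simp [inner_tangentPart]
  ring

theorem integral_deriv_mul_add [IsManifold (𝓡 n) ∞ M] [T2Space M] [SigmaCompactSpace M]
    [MeasurableSpace M] [BorelSpace M] (hX : IsIsometricImmersion n X) (hs : IsSelfShrinker n X)
    (hK : ∀ R : ℝ, IsCompact {p | ‖X p‖ ^ 2 / 4 ≤ R}) {η : ℝ → ℝ} {R : ℝ} (hη : ContDiff ℝ ∞ η)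
    (h0 : ∀ s, R ≤ s → η s = 0) :
    ∫ p, (deriv η (‖X p‖ ^ 2 / 4) * (‖tangentPart n X p‖ ^ 2 / 4) +
      η (‖X p‖ ^ 2 / 4) * (n / 2 - ‖normalPart n X p (X p)‖ ^ 2 / 4))
        ∂riemannianVolume n M = 0 := by
  have hsq : ContDiff ℝ ∞ fun x : Euc k => η (‖x‖ ^ 2 / 4) :=
    hη.comp ((contDiff_norm_sq ℝ).div_const 4)
  have hu : ContMDiff (𝓡 n) 𝓘(ℝ, ℝ) ∞ fun q => η (‖X q‖ ^ 2 / 4) := hsq.contMDiff.comp hX.1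
  have hc : HasCompactSupport fun q => η (‖X q‖ ^ 2 / 4) :=
    HasCompactSupport.intro (hK R) fun p hp => h0 _ (not_le.1 hp).le
  have h := integral_shrinkerDiv hX hs hu hc
  -- X^T = 2∇f, so the divergence of η(f) X^T is twice the integrand.
  rw [← mul_right_inj' (two_ne_zero (α := ℝ)), mul_zero, ← h, ← integral_const_mul]
  refine integral_congr_ae (Filter.Eventually.of_forall fun p => ?_)
  simp only [shrinkerDiv, positionDeriv_comp_norm_sq hX hη]
  ring

end SelfShrinker

end

theorem mainTheorem7 (n m : ℕ) {M : Type*} [EMetricSpace M] [ChartedSpace (Euc n) M]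
    [IsManifold (𝓡 n) ∞ M]
    [RiemannianBundle (fun p : M => TangentSpace (𝓡 n) p)]
    [IsContMDiffRiemannianBundle (𝓡 n) ∞ (Euc n) (fun p : M => TangentSpace (𝓡 n) p)]
    [IsRiemannianManifold (𝓡 n) M]
    [MeasurableSpace M] [BorelSpace M] [CompleteSpace M] [NoncompactSpace M]
    (X : M → Euc (n + m)) (hX : IsIsometricImmersion n X) (hproper : IsProperMap X)
    (hshrink : IsSelfShrinker n X) :
    ∀ t : ℝ, 0 < t →
      Integrable (gaussianWeight X t) (riemannianVolume n M) ∧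
        gaussianArea n X t Set.univ ≤ gaussianArea n X 1 Set.univ := by
  intro t ht
  have hK (R : ℝ) : IsCompact {p | ‖X p‖ ^ 2 / 4 ≤ R} := by
    refine (hproper.isCompact_preimage (isCompact_closedBall 0 √(4 * R))).of_isClosed_subset
      (isClosed_le ((hproper.continuous.norm.pow 2).div_const 4) continuous_const) fun p hp => ?_
    rw [Set.mem_preimage, mem_closedBall_zero_iff]
    refine Real.le_sqrt_of_sq_le ?_
    have : ‖X p‖ ^ 2 / 4 ≤ R := hp
    linarith
  -- Properness exhausts M by compact sublevel sets of |X|²/4; σ-compactness is what the partition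
  -- of unity requires.
  have hσ : SigmaCompactSpace M := by
    refine ⟨fun j : ℕ => {p | ‖X p‖ ^ 2 / 4 ≤ (j : ℝ)}, fun j => hK j, ?_⟩
    refine Set.eq_univ_of_forall fun p => ?_
    obtain ⟨j, hj⟩ := exists_nat_ge (‖X p‖ ^ 2 / 4)
    exact Set.mem_iUnion.2 ⟨j, hj⟩
  have hlf := isLocallyFiniteMeasure_riemannianVolume hX
  have hXc := hproper.continuous
  have hT : Continuous (tangentPart n X) :=
    continuous_iff_continuousAt.2 fun p => (mdifferentiableAt_tangentPart hX p).continuousAt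
  have hN := continuous_normalPart hX
  obtain ⟨hint, hle⟩ := integrable_exp_and_rpow_mul_integral_le (μ := riemannianVolume n M)
    (f := fun p => ‖X p‖ ^ 2 / 4) (a := fun p => ‖tangentPart n X p‖ ^ 2 / 4)
    (b := fun p => ‖normalPart n X p (X p)‖ ^ 2 / 4) (d := n / 2) hK (by fun_prop) (by fun_prop)
    (by fun_prop) (fun p => by positivity) (fun p => by positivity)
    (fun p => by rw [← norm_tangentPart_sq_add (n := n) X p, add_div]) (by positivity)
    (fun η R hη h0 => integral_deriv_mul_add hX hshrink hK hη h0) (inv_pos.2 ht)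
  have hw (s : ℝ) : gaussianWeight X s = fun p => Real.exp (-s⁻¹ * (‖X p‖ ^ 2 / 4)) := by
    funext p
    rw [gaussianWeight, neg_div, neg_mul, mul_comm 4 s, ← div_div, div_right_comm,
      div_eq_inv_mul _ s]
  refine ⟨by rwa [hw t], ?_⟩
  rw [gaussianArea, gaussianArea, setIntegral_univ, setIntegral_univ, hw, hw, inv_one, mul_one]
  -- The normalization of F_t supplies the factor β^d with β = 1/t and d = n/2.
  have h4 : (4 * π * t) ^ (-(n : ℝ) / 2) = (4 * π) ^ (-(n : ℝ) / 2) * t⁻¹ ^ ((n : ℝ) / 2) := by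
    rw [Real.mul_rpow (by positivity) ht.le, neg_div, Real.rpow_neg ht.le, Real.inv_rpow ht.le]
  rw [h4, mul_assoc]
  exact mul_le_mul_of_nonneg_left hle (by positivity)
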